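/- **Setting.** Let $\mathcal P$ be a protograph (a finite bipartite multigraph with edge set $\mathscr E$) with check nodes (CNs) $\mathsf c_1,\dots,\mathsf c_{n_0}$ ($n_0\ge 1$) and variable nodes (VNs) $\mathsf v_1,\dots,\mathsf v_{h_0+n_0}$, the first $h_0$ of which are punctured. Let $\mathscr E_{\mathsf v_j}$, $\mathscr E_{\mathsf c_i}$ be the sets of edges at $\mathsf v_j$, $\mathsf c_i$, let $\mathsf d_{\mathsf v_j}=|\mathscr E_{\mathsf v_j}|$, and let $H(p)=-p\ln p-(1-p)\ln(1-p)$. For $\ell\ge 1$ put $n=n_0\ell$; a random code of the ensemble is the binary code whose Tanner graph is obtained by taking $\ell$ copies of $\mathcal P$ and permuting the $\ell$ copies of each edge type by independent uniform permutations. Let $\bar A^{\mathsf{IO}}_{a,b}$ be the expected number of its codewords with $a$ ones on the punctured and $b$ ones on the unpunctured coordinates. For $0\le\alpha\le h_0/n_0$, $0\le\beta\le1$ let $$G(\alpha,\beta)=\lim \tfrac1n\ln\bar A^{\mathsf{IO}}_{a,b},$$ the limit being taken along all integer $(\ell,a,b)$ with $\ell\to\infty$, $a/n\to\alpha$, $b/n\to\beta$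 and $\bar A^{\mathsf{IO}}_{a,b}>0$ (in particular along $a=\alpha n$, $b=\beta n$ when these are integers). For $\boldsymbol z=(z_g)_{g\in\mathscr E}$ with all $z_g>0$ and $\boldsymbol\delta=(\delta_j)_{1\le j\le h_0+n_0}$ put $$S_i(\boldsymbol z_i)=\tfrac12\Big[\prod_{g\in\mathscr E_{\mathsf c_i}}(1+z_g)+\prod_{g\in\mathscr E_{\mathsf c_i}}(1-z_g)\Big],$$ $$F(\boldsymbol z,\boldsymbol\delta)=\frac1{n_0}\sum_{i=1}^{n_0}\ln S_i(\boldsymbol z_i)-\sum_{j=1}^{h_0+n_0}\Big[\frac{\mathsf d_{\mathsf v_j}-1}{n_0}H(n_0\delta_j)+\delta_j\sum_{g\in\mathscr E_{\mathsf v_j}}\ln z_g\Big],\qquad J(\boldsymbol\delta)=\inf_{\boldsymbol z>0}F(\boldsymbol z,\boldsymbol\delta).$$ Call $\boldsymbol\delta$ *optimal* if it maximizes $J$ over all $\boldsymbol\delta$ with $0\le\delta_j\le 1/n_0$, $\sum_{j\le h_0}\delta_j=\alpha$, $\sum_{j>h_0}\delta_j=\beta$. Consider the system of $|\mathscr E|+h_0+n_0+2$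 equations $$z_g\frac{\partial\ln S_i(\boldsymbol z_i)}{\partial z_g}=n_0\delta_j\quad(g\in\mathscr E_{\mathsf c_i}\cap\mathscr E_{\mathsf v_j}),\tag{1}$$ $$(\mathsf d_{\mathsf v_j}-1)\ln\frac{\delta_j}{\frac1{n_0}-\delta_j}=\sum_{g\in\mathscr E_{\mathsf v_j}}\ln z_g+\mu_1\ (j\le h_0),\qquad(\mathsf d_{\mathsf v_j}-1)\ln\frac{\delta_j}{\frac1{n_0}-\delta_j}=\sum_{g\in\mathscr E_{\mathsf v_j}}\ln z_g+\mu_2\ (j>h_0),\tag{2}$$ $$\sum_{j\le h_0}\delta_j=\alpha,\qquad\sum_{j>h_0}\delta_j=\beta,\tag{3}$$ in the unknowns $z_g>0$, $0<\delta_j<1/n_0$, $\mu_1,\mu_2\in\mathbb R$. **Theorem.** (a) An optimal $\boldsymbol\delta^\star$ exists. If $J(\boldsymbol\delta^\star)>-\infty$, then $G(\alpha,\beta)$ exists (the limit is over a nonempty family of weights with arbitrarily large $\ell$) and equals $J(\boldsymbol\delta^\star)$. If $J(\boldsymbol\delta^\star)=-\infty$, then $\bar A^{\mathsf{IO}}_{a,b}=0$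 for all large $\ell$ and all $(a/n,b/n)$ close to $(\alpha,\beta)$. (b) If $\boldsymbol z>0$ satisfies (1) at $\boldsymbol\delta$, then $J(\boldsymbol\delta)=F(\boldsymbol z,\boldsymbol\delta)$. Hence if $\boldsymbol\delta^\star$ is optimal and $\boldsymbol z^\star>0$ satisfies (1) at $\boldsymbol\delta^\star$, then $$G(\alpha,\beta)=\frac1{n_0}\sum_{i=1}^{n_0}\ln S_i(\boldsymbol z_i^\star)-\sum_{j=1}^{h_0+n_0}\Big[\frac{\mathsf d_{\mathsf v_j}-1}{n_0}H(n_0\delta_j^\star)+\delta_j^\star\sum_{g\in\mathscr E_{\mathsf v_j}}\ln z_g^\star\Big].$$ (c) If $\boldsymbol\delta^\star$ is optimal, $0<\delta^\star_j<1/n_0$ for all $j$, and (1) has a positive solution at $\boldsymbol\delta^\star$, then there are $\boldsymbol z^\star,\mu_1,\mu_2$ such that $(\boldsymbol z^\star,\boldsymbol\delta^\star,\mu_1,\mu_2)$ solves (1)–(3), and $G(\alpha,\beta)=F(\boldsymbol z^\star,\boldsymbol\delta^\star)$. (d) Every solution $(\boldsymbol z,\boldsymbol\delta,\mu_1,\mu_2)$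 of (1)–(3) satisfies $F(\boldsymbol z,\boldsymbol\delta)\le G(\alpha,\beta)$ whenever $G(\alpha,\beta)$ exists, with existence of $G(\alpha,\beta)$ and equality if $\boldsymbol\delta$ is optimal. -/

import Mathlib

open Filter Topology

/-- A protograph with `h₀` punctured variable-node types, `n₀` unpunctured variable-node types,
`n₀` check-node types and edge set `E`; parallel edges are allowed. Variable-node types are
`Sum.inl j` (punctured, input) and `Sum.inr j` (unpunctured, output). -/
structure Protograph (h₀ n₀ : ℕ) (E : Type*) where
  /-- the variable node at the end of an edge -/
  vn : E → Fin h₀ ⊕ Fin n₀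
  /-- the check node at the end of an edge -/
  cn : E → Fin n₀

namespace Protograph

noncomputable section

variable {h₀ n₀ : ℕ} {E : Type*} [Fintype E] [DecidableEq E]

/-- Edges at the variable node `j`. -/
def edgesV (P : Protograph h₀ n₀ E) (j : Fin h₀ ⊕ Fin n₀) : Finset E :=
  Finset.univ.filter fun g => P.vn g = j

/-- Edges at the check node `i`. -/
def edgesC (P : Protograph h₀ n₀ E) (i : Fin n₀) : Finset E :=
  Finset.univ.filter fun g => P.cn g = i

/-- Degree of the variable node `j`. -/
def degV (P : Protograph h₀ n₀ E) (j : Fin h₀ ⊕ Fin n₀) : ℕ := (P.edgesV j).card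

/-! ### The lifted code ensemble -/

/-- Parity-check matrix of the lifted graph: the copy `t` of the edge type `g` joins the copy `t`
of its check node to the copy `π g t` of its variable node; entries count edges modulo 2. -/
def parityCheck (P : Protograph h₀ n₀ E) {l : ℕ} (π : E → Equiv.Perm (Fin l)) :
    Matrix (Fin n₀ × Fin l) ((Fin h₀ ⊕ Fin n₀) × Fin l) (ZMod 2) :=
  fun r c =>
    ((Finset.univ.filter fun g : E => P.cn g = r.1 ∧ P.vn g = c.1 ∧ π g r.2 = c.2).card : ZMod 2)

/-- Number of codewords of the lifted mother code with `a` ones on the punctured (input)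
coordinates and `b` ones on the unpunctured (output) coordinates. -/
def ioCount (P : Protograph h₀ n₀ E) {l : ℕ} (π : E → Equiv.Perm (Fin l)) (a b : ℕ) : ℕ :=
  (Finset.univ.filter fun x : (Fin h₀ ⊕ Fin n₀) × Fin l → ZMod 2 =>
    (P.parityCheck π).mulVec x = 0 ∧
    hammingNorm (fun p : Fin h₀ × Fin l => x (Sum.inl p.1, p.2)) = a ∧
    hammingNorm (fun p : Fin n₀ × Fin l => x (Sum.inr p.1, p.2)) = b).card

/-- Average input-output weight enumerator: the edge permutations are independent and uniform. -/
def avgEnum (P : Protograph h₀ n₀ E) (l a b : ℕ) : ℝ :=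
  (∑ π : E → Equiv.Perm (Fin l), (P.ioCount π a b : ℝ)) /
    (Fintype.card (E → Equiv.Perm (Fin l)) : ℝ)

/-- Triples `(l, a, b)` with `l → ∞`, `a / n → α` and `b / n → β`, where `n = n₀ * l`. -/
def weightFilter (n₀ : ℕ) (α β : ℝ) : Filter (ℕ × ℕ × ℕ) :=
  comap (fun t => t.1) atTop ⊓
  comap (fun t => (t.2.1 : ℝ) / ((n₀ : ℝ) * t.1)) (𝓝 α) ⊓
  comap (fun t => (t.2.2 : ℝ) / ((n₀ : ℝ) * t.1)) (𝓝 β)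

/-- The same, restricted to the weights that occur in the ensemble (where the logarithm of the
average enumerator makes sense). -/
def ioFilter (P : Protograph h₀ n₀ E) (α β : ℝ) : Filter (ℕ × ℕ × ℕ) :=
  weightFilter n₀ α β ⊓ 𝓟 {t | 0 < P.avgEnum t.1 t.2.1 t.2.2}

/-- `G` is the normalized logarithmic asymptotic input-output weight distribution at `(α, β)`:
admissible triples exist arbitrarily far out, and `(1/n) ln` of the average enumerator tends to
`G` along all of them, in particular along `a = α n`, `b = β n`. -/
def HasRate (P : Protograph h₀ n₀ E) (α β G : ℝ) : Prop :=
  (P.ioFilter α β).NeBot ∧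
  Tendsto (fun t : ℕ × ℕ × ℕ =>
    1 / ((n₀ : ℝ) * t.1) * Real.log (P.avgEnum t.1 t.2.1 t.2.2)) (P.ioFilter α β) (𝓝 G)

/-! ### The asymptotic formula and the system of equations -/

/-- Generating function of the check node `i`. -/
def S (P : Protograph h₀ n₀ E) (i : Fin n₀) (z : E → ℝ) : ℝ :=
  1 / 2 * (∏ g ∈ P.edgesC i, (1 + z g) + ∏ g ∈ P.edgesC i, (1 - z g))

/-- The explicit expression for the asymptotic distribution, at arbitrary `z` and `δ`. -/
def Gexpr (P : Protograph h₀ n₀ E) (z : E → ℝ) (δ : Fin h₀ ⊕ Fin n₀ → ℝ) : ℝ :=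
  1 / (n₀ : ℝ) * ∑ i, Real.log (P.S i z) -
    ∑ j, (((P.degV j : ℝ) - 1) / n₀ * Real.binEntropy (n₀ * δ j) +
      δ j * ∑ g ∈ P.edgesV j, Real.log (z g))

/-- `z` is a positive solution of the saddle-point equations at the normalized weights `δ`:
`z_g ∂ ln S_i / ∂ z_g = n₀ δ_j` for every edge `g` joining check `i` and variable node `j`. -/
def IsSaddle (P : Protograph h₀ n₀ E) (z : E → ℝ) (δ : Fin h₀ ⊕ Fin n₀ → ℝ) : Prop :=
  (∀ g, 0 < z g) ∧
  ∀ g, z g * deriv (fun t => Real.log (P.S (P.cn g) (Function.update z g t))) (z g) =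
    n₀ * δ (P.vn g)

/-- Exponent contributed by the variable-node weights `n δ`. -/
def J (P : Protograph h₀ n₀ E) (δ : Fin h₀ ⊕ Fin n₀ → ℝ) : EReal :=
  ⨅ z ∈ {z : E → ℝ | ∀ g, 0 < z g}, (P.Gexpr z δ : EReal)

/-- Normalized weight vectors with total input weight `α` and total output weight `β`. -/
def weights (h₀ n₀ : ℕ) (α β : ℝ) : Set (Fin h₀ ⊕ Fin n₀ → ℝ) :=
  {δ | (∀ j, 0 ≤ δ j ∧ δ j ≤ 1 / (n₀ : ℝ)) ∧
    ∑ j, δ (Sum.inl j) = α ∧ ∑ j, δ (Sum.inr j) = β}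

/-- `δ` is an optimal normalized weight vector. -/
def IsOptimal (P : Protograph h₀ n₀ E) (α β : ℝ) (δ : Fin h₀ ⊕ Fin n₀ → ℝ) : Prop :=
  δ ∈ weights h₀ n₀ α β ∧ IsMaxOn P.J (weights h₀ n₀ α β) δ

/-- `(z, δ, μ₁, μ₂)` solves the full system of `|E| + h₀ + n₀ + 2` equations; `z_g > 0` and
`0 < δ_j < 1 / n₀`, so that all the logarithms make sense. -/
structure IsSolution (P : Protograph h₀ n₀ E) (α β : ℝ) (z : E → ℝ)
    (δ : Fin h₀ ⊕ Fin n₀ → ℝ) (μ₁ μ₂ : ℝ) : Prop where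
  interior : ∀ j, 0 < δ j ∧ δ j < 1 / (n₀ : ℝ)
  saddle : P.IsSaddle z δ
  stationary_in : ∀ j : Fin h₀, ((P.degV (Sum.inl j) : ℝ) - 1) *
    Real.log (δ (Sum.inl j) / (1 / (n₀ : ℝ) - δ (Sum.inl j))) =
      ∑ g ∈ P.edgesV (Sum.inl j), Real.log (z g) + μ₁
  stationary_out : ∀ j : Fin n₀, ((P.degV (Sum.inr j) : ℝ) - 1) *
    Real.log (δ (Sum.inr j) / (1 / (n₀ : ℝ) - δ (Sum.inr j))) =
      ∑ g ∈ P.edgesV (Sum.inr j), Real.log (z g) + μ₂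
  sum_in : ∑ j, δ (Sum.inl j) = α
  sum_out : ∑ j, δ (Sum.inr j) = β

end

end Protograph

/-! Averaging over independent edge permutations gives an exact finite sum over the weight vectors
`w` of the variable-node types (`avgEnum_eq_sum`). Each term is a quotient of binomials times the
number of words of length `l` whose letters are configurations (edge sets meeting every check
evenly) and in which each edge occurs as often as its variable node prescribes. There are only
polynomially many `w`, so the largest term fixes the exponent. The binomials give the entropies `H`
with coefficients `1 - d`; the word count has as exponent the maximal entropy of a distribution `κ`
on configurations with edge marginals `n₀ δ`.

That maximum is dual to the infimum over `z`: the product of the `S i` is the partition function of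
the configurations at `log z` (`prod_S`), and `Gexpr` is the dual objective up to the `H` terms.
Weak duality is Gibbs' inequality. The converse, also for boundary marginals where no minimising `z`
exists, is `exists_marginals_entropy_ge`, obtained by a quadratic penalty and compactness. The
saddle-point equations say that the Gibbs distribution of `z` has the required marginals, so there
the duality is tight.

The upper bound on the rate follows from compactness and one well-chosen `z`. The lower bound needs
integer counts close to `l κ` with exactly the given `(l, a, b)`, and arithmetic may obstruct this.
`exists_nat_solutions_tendsto` shows that the existence of any natural solution suffices: the
solution nearest to `l κ` must converge to `κ` after rescaling, since otherwise an integer kernel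
vector would bring it closer. If the exponent is `-∞`, the enumerators vanish because nonzero ones
are at least exponentially small.

For the multipliers, the gradient at an interior optimum annihilates every perturbation of `δ` that
keeps both totals and lifts to `κ`. The Fredholm alternative writes it as two multipliers plus
vertex sums of neutral edge weights. The latter are absorbed into `z`, which therefore may differ
from the given saddle point. -/

/-! ### Maximum entropy duality for finite exponential families -/

section MaxEntropy

variable {U E : Type*} [Fintype U] [Fintype E]

/-- Logarithm of the partition function of the exponential family with statistics `M`. -/
noncomputable def logPartition (M : U → E → ℝ) (s : E → ℝ) : ℝ :=
  Real.log (∑ u, Real.exp (∑ g, M u g * s g))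

/-- Weights of the exponential family with statistics `M`. -/
noncomputable def gibbsWeight (M : U → E → ℝ) (s : E → ℝ) (u : U) : ℝ :=
  Real.exp (∑ g, M u g * s g) / ∑ u, Real.exp (∑ g, M u g * s g)

theorem partition_pos [Nonempty U] (M : U → E → ℝ) (s : E → ℝ) :
    0 < ∑ u, Real.exp (∑ g, M u g * s g) :=
  Finset.sum_pos (fun _ _ => Real.exp_pos _) Finset.univ_nonempty

theorem gibbsWeight_pos [Nonempty U] (M : U → E → ℝ) (s : E → ℝ) (u : U) :
    0 < gibbsWeight M s u :=
  div_pos (Real.exp_pos _) (partition_pos M s)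

theorem sum_gibbsWeight [Nonempty U] (M : U → E → ℝ) (s : E → ℝ) :
    ∑ u, gibbsWeight M s u = 1 := by
  simp only [gibbsWeight, ← Finset.sum_div]
  exact div_self (partition_pos M s).ne'

theorem log_gibbsWeight [Nonempty U] (M : U → E → ℝ) (s : E → ℝ) (u : U) :
    Real.log (gibbsWeight M s u) = ∑ g, M u g * s g - logPartition M s := by
  rw [gibbsWeight, Real.log_div (Real.exp_pos _).ne' (partition_pos M s).ne', Real.log_exp,
    logPartition]

theorem sum_mul_sum_comm (M : U → E → ℝ) (s : E → ℝ) (κ : U → ℝ) (θ : E → ℝ)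
    (hθ : ∀ g, ∑ u, κ u * M u g = θ g) :
    ∑ u, κ u * ∑ g, M u g * s g = ∑ g, θ g * s g := by
  simp only [Finset.mul_sum, ← hθ, Finset.sum_mul]
  rw [Finset.sum_comm]
  simp only [mul_assoc]

/-- The logarithm of a Gibbs weight is affine in the statistics, so its mean depends on the
marginals alone. This is the equality case of Gibbs' inequality. -/
theorem sum_negMulLog_gibbsWeight [Nonempty U] (M : U → E → ℝ) (s θ : E → ℝ)
    (hθ : ∀ g, ∑ u, gibbsWeight M s u * M u g = θ g) :
    ∑ u, Real.negMulLog (gibbsWeight M s u) = logPartition M s - ∑ g, θ g * s g := by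
  have h : ∀ u, Real.negMulLog (gibbsWeight M s u) =
      gibbsWeight M s u * logPartition M s - gibbsWeight M s u * ∑ g, M u g * s g := by
    intro u
    rw [Real.negMulLog, log_gibbsWeight]
    ring
  simp only [h, Finset.sum_sub_distrib, ← Finset.sum_mul, sum_gibbsWeight, one_mul]
  rw [sum_mul_sum_comm M s _ θ hθ]

/-- Gibbs' variational inequality. -/
theorem sum_negMulLog_le_logPartition [Nonempty U] (M : U → E → ℝ) (s θ : E → ℝ) (κ : U → ℝ)
    (h0 : ∀ u, 0 ≤ κ u) (h1 : ∑ u, κ u = 1) (hθ : ∀ g, ∑ u, κ u * M u g = θ g) :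
    ∑ u, Real.negMulLog (κ u) ≤ logPartition M s - ∑ g, θ g * s g := by
  -- Termwise `log x ≤ x - 1` at the ratio of the Gibbs weight to `κ u`; where `κ u = 0` only
  -- positivity of the Gibbs weight remains.
  have key : ∀ u, Real.negMulLog (κ u) + κ u * ∑ g, M u g * s g - κ u * logPartition M s ≤
      gibbsWeight M s u - κ u := by
    intro u
    rcases (h0 u).eq_or_lt with h | h
    · rw [← h]
      simpa using (gibbsWeight_pos M s u).le
    · have h2 := Real.log_le_sub_one_of_pos (div_pos (gibbsWeight_pos M s u) h)
      rw [Real.log_div (gibbsWeight_pos M s u).ne' h.ne', log_gibbsWeight] at h2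
      have h3 := mul_le_mul_of_nonneg_left h2 h.le
      have h4 : κ u * (gibbsWeight M s u / κ u - 1) = gibbsWeight M s u - κ u := by
        field_simp
      rw [h4] at h3
      rw [Real.negMulLog]
      linarith
  have hs := Finset.sum_le_sum fun u (_ : u ∈ Finset.univ) => key u
  simp only [Finset.sum_sub_distrib, Finset.sum_add_distrib, sum_gibbsWeight, h1,
    ← Finset.sum_mul, sum_mul_sum_comm M s κ θ hθ, one_mul] at hs
  linarith

theorem continuous_logPartition [Nonempty U] (M : U → E → ℝ) : Continuous (logPartition M) := by
  unfold logPartition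
  refine Continuous.log (by fun_prop) fun s => (partition_pos M s).ne'

theorem hasDerivAt_logPartition [Nonempty U] [DecidableEq E] (M : U → E → ℝ) (s : E → ℝ) (g : E) :
    HasDerivAt (fun t => logPartition M (Function.update s g t))
      (∑ u, gibbsWeight M s u * M u g) (s g) := by
  have hin : ∀ u, HasDerivAt (fun t => ∑ g', M u g' * Function.update s g t g') (M u g) (s g) := by
    intro u
    have h : ∀ g' ∈ Finset.univ, HasDerivAt (fun t => M u g' * Function.update s g t g')
        (if g' = g then M u g' else 0) (s g) := by
      intro g' _
      by_cases hg : g' = g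
      · subst hg
        simpa using (hasDerivAt_id (s g')).const_mul (M u g')
      · simpa [hg] using hasDerivAt_const (s g) (M u g' * s g')
    simpa using HasDerivAt.fun_sum h
  have hs := HasDerivAt.fun_sum fun u (_ : u ∈ Finset.univ) => (hin u).exp
  have hl := hs.log (by simpa using (partition_pos M s).ne')
  simp only [Function.update_eq_self] at hl
  convert hl using 1
  · rfl
  · rw [Finset.sum_div]
    refine Finset.sum_congr rfl fun u _ => ?_
    rw [gibbsWeight]
    ring

/-- The penalised dual problem has a solution; it gives a distribution of large entropy with
approximately the prescribed marginals. -/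
theorem exists_gibbsWeight_approx [Nonempty U] (M : U → E → ℝ) (θ : E → ℝ) (B : ℝ)
    (hB : ∀ s, B ≤ logPartition M s - ∑ g, θ g * s g) {ε : ℝ} (hε : 0 < ε) :
    ∃ s : E → ℝ, B ≤ ∑ u, Real.negMulLog (gibbsWeight M s u) ∧
      ∀ g, (∑ u, gibbsWeight M s u * M u g - θ g) ^ 2 ≤ 4 * ε * (logPartition M 0 - B) := by
  classical
  -- The dual objective is bounded below by `B` but need not attain its infimum; the quadratic
  -- penalty makes it coercive.
  set φ : (E → ℝ) → ℝ := fun s => logPartition M s - ∑ g, θ g * s g + ε * ∑ g, s g ^ 2 with hφ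
  have hcont : Continuous φ := by
    have := continuous_logPartition M
    simp only [hφ]
    fun_prop
  have hnorm : ∀ s : E → ℝ, ‖s‖ ^ 2 ≤ ∑ g, s g ^ 2 := by
    intro s
    have h0 : 0 ≤ ∑ g, s g ^ 2 := Finset.sum_nonneg fun _ _ => sq_nonneg _
    have h : ‖s‖ ≤ √(∑ g, s g ^ 2) := by
      refine (pi_norm_le_iff_of_nonneg (Real.sqrt_nonneg _)).2 fun g => ?_
      rw [Real.norm_eq_abs]
      refine Real.abs_le_sqrt ?_
      exact Finset.single_le_sum (f := fun g => s g ^ 2) (fun _ _ => sq_nonneg _)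
        (Finset.mem_univ g)
    calc ‖s‖ ^ 2 ≤ √(∑ g, s g ^ 2) ^ 2 := by gcongr
      _ = _ := Real.sq_sqrt h0
  have htend : Tendsto φ (cocompact (E → ℝ)) atTop := by
    have h1 : Tendsto (fun s : E → ℝ => B + ε * ‖s‖ ^ 2) (cocompact (E → ℝ)) atTop := by
      refine tendsto_atTop_add_const_left _ _ (Tendsto.const_mul_atTop hε ?_)
      exact (tendsto_pow_atTop two_ne_zero).comp (tendsto_norm_cocompact_atTop)
    refine tendsto_atTop_mono (fun s => ?_) h1
    have := mul_le_mul_of_nonneg_left (hnorm s) hε.le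
    have := hB s
    simp only [hφ]
    linarith
  obtain ⟨s, hs⟩ := hcont.exists_forall_le htend
  -- At the minimiser the marginal error is exactly the gradient of the penalty, up to sign.
  have hderiv : ∀ g, ∑ u, gibbsWeight M s u * M u g - θ g + ε * (2 * s g) = 0 := by
    intro g
    have hlin : ∀ g' ∈ Finset.univ, HasDerivAt (fun t => θ g' * Function.update s g t g')
        (if g' = g then θ g' else 0) (s g) := by
      intro g' _
      by_cases hg : g' = g
      · subst hg
        simpa using (hasDerivAt_id (s g')).const_mul (θ g')
      · simpa [hg] using hasDerivAt_const (s g) (θ g' * s g')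
    have hsq : ∀ g' ∈ Finset.univ, HasDerivAt (fun t => Function.update s g t g' ^ 2)
        (if g' = g then 2 * s g' else 0) (s g) := by
      intro g' _
      by_cases hg : g' = g
      · subst hg
        simpa using hasDerivAt_pow 2 (s g')
      · simpa [hg] using hasDerivAt_const (s g) (s g' ^ 2)
    have h := (((hasDerivAt_logPartition M s g).sub (HasDerivAt.fun_sum hlin)).add
      ((HasDerivAt.fun_sum hsq).const_mul ε))
    simp only [Finset.sum_ite_eq', Finset.mem_univ, if_true] at h
    refine IsLocalMin.hasDerivAt_eq_zero (f := fun t => φ (Function.update s g t)) ?_ h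
    refine Eventually.of_forall fun t => ?_
    simpa using hs (Function.update s g t)
  have hsum : ∑ u, Real.negMulLog (gibbsWeight M s u) =
      logPartition M s - ∑ g, θ g * s g + 2 * (ε * ∑ g, s g ^ 2) := by
    rw [sum_negMulLog_gibbsWeight M s (fun g => θ g - ε * (2 * s g))
      (fun g => by linarith [hderiv g])]
    have : ∑ g, (θ g - ε * (2 * s g)) * s g = ∑ g, θ g * s g - 2 * (ε * ∑ g, s g ^ 2) := by
      rw [Finset.mul_sum, Finset.mul_sum, ← Finset.sum_sub_distrib]
      exact Finset.sum_congr rfl fun g _ => by ring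
    rw [this]
    ring
  have hnn : 0 ≤ ε * ∑ g, s g ^ 2 :=
    mul_nonneg hε.le (Finset.sum_nonneg fun _ _ => sq_nonneg _)
  refine ⟨s, by linarith [hB s], fun g => ?_⟩
  -- Comparing the minimiser with `s = 0` bounds the penalty; the squared marginal error is `4 * ε`
  -- times one penalty term.
  have h0 : φ s ≤ logPartition M 0 := by simpa [hφ] using hs 0
  have h1 : ε * s g ^ 2 ≤ logPartition M 0 - B := by
    have h2 : ε * s g ^ 2 ≤ ε * ∑ g, s g ^ 2 := by
      gcongr
      exact Finset.single_le_sum (f := fun g => s g ^ 2) (fun _ _ => sq_nonneg _)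
        (Finset.mem_univ g)
    have h3 := hB s
    simp only [hφ] at h0
    linarith
  have h4 : ∑ u, gibbsWeight M s u * M u g - θ g = -(ε * (2 * s g)) := by linarith [hderiv g]
  rw [h4]
  nlinarith [mul_le_mul_of_nonneg_left h1 hε.le]

/-- Maximum entropy duality, including marginals on the boundary of the marginal polytope. -/
theorem exists_marginals_entropy_ge [Nonempty U] (M : U → E → ℝ) (θ : E → ℝ) (B : ℝ)
    (hB : ∀ s, B ≤ logPartition M s - ∑ g, θ g * s g) :
    ∃ κ : U → ℝ, (∀ u, 0 ≤ κ u) ∧ ∑ u, κ u = 1 ∧ (∀ g, ∑ u, κ u * M u g = θ g) ∧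
      B ≤ ∑ u, Real.negMulLog (κ u) := by
  choose s hs1 hs2 using fun n : ℕ =>
    exists_gibbsWeight_approx M θ B hB (ε := 1 / ((n : ℝ) + 1)) (by positivity)
  have hmem : ∀ n, gibbsWeight M (s n) ∈ Set.pi Set.univ fun _ : U => Set.Icc (0 : ℝ) 1 := by
    intro n u _
    refine ⟨(gibbsWeight_pos M (s n) u).le, ?_⟩
    rw [← sum_gibbsWeight M (s n)]
    exact Finset.single_le_sum (fun v _ => (gibbsWeight_pos M (s n) v).le) (Finset.mem_univ u)
  -- The tilts `s n` may diverge, but their Gibbs distributions stay in a cube; a limit has exact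
  -- marginals because the penalty tends to zero.
  obtain ⟨κ, hκ, φ, hφ, hlim⟩ := (isCompact_univ_pi fun _ : U => isCompact_Icc).tendsto_subseq hmem
  have hu : ∀ u, Tendsto (fun n => gibbsWeight M (s (φ n)) u) atTop (𝓝 (κ u)) :=
    fun u => (tendsto_pi_nhds.1 hlim) u
  refine ⟨κ, fun u => (hκ u trivial).1, ?_, fun g => ?_, ?_⟩
  · refine tendsto_nhds_unique (tendsto_finsetSum _ fun u _ => hu u) ?_
    simp only [sum_gibbsWeight]
    exact tendsto_const_nhds
  · have h1 : Tendsto (fun n => (∑ u, gibbsWeight M (s (φ n)) u * M u g - θ g) ^ 2) atTop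
        (𝓝 ((∑ u, κ u * M u g - θ g) ^ 2)) :=
      ((tendsto_finsetSum _ fun u _ => (hu u).mul_const (M u g)).sub_const _).pow 2
    have h2 : Tendsto (fun n => 4 * (1 / (((φ n : ℕ) : ℝ) + 1)) * (logPartition M 0 - B)) atTop
        (𝓝 (4 * 0 * (logPartition M 0 - B))) :=
      ((tendsto_one_div_add_atTop_nhds_zero_nat.comp hφ.tendsto_atTop).const_mul 4).mul_const _
    have h3 := le_of_tendsto_of_tendsto' h1 h2 fun n => hs2 (φ n) g
    have h4 : (∑ u, κ u * M u g - θ g) ^ 2 = 0 :=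
      le_antisymm (by simpa using h3) (sq_nonneg _)
    linarith [pow_eq_zero_iff (two_ne_zero) |>.1 h4]
  · refine ge_of_tendsto' (tendsto_finsetSum _ fun u _ =>
      (Real.continuous_negMulLog.tendsto _).comp (hu u)) fun n => ?_
    exact hs1 (φ n)

end MaxEntropy

/-! ### Integer points near real solutions of linear systems -/

section IntegerPoints

variable {U ι : Type*} [Fintype U]

/-- Simultaneous approximation: the multiples of a real vector come close to integer vectors. -/
theorem exists_nat_mul_near_int (x : U → ℝ) {ε : ℝ} (hε : 0 < ε) :
    ∃ (N : ℕ) (m : U → ℤ), 0 < N ∧ ∀ u, |(N : ℝ) * x u - m u| < ε := by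
  have hmem : ∀ n : ℕ, (fun u => Int.fract ((n : ℝ) * x u)) ∈
      Set.pi Set.univ fun _ : U => Set.Icc (0 : ℝ) 1 :=
    fun n u _ => ⟨Int.fract_nonneg _, (Int.fract_lt_one _).le⟩
  obtain ⟨y, -, φ, hφ, hlim⟩ := (isCompact_univ_pi fun _ : U => isCompact_Icc).tendsto_subseq hmem
  -- Fractional parts of the multiples live in a cube, so two of them nearly agree; the difference
  -- of the two multipliers is the desired `N`.
  obtain ⟨K, hK⟩ := Metric.cauchySeq_iff.1 hlim.cauchySeq ε hε
  have hlt : φ K < φ (K + 1) := hφ K.lt_succ_self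
  refine ⟨φ (K + 1) - φ K, fun u => ⌊(φ (K + 1) : ℝ) * x u⌋ - ⌊(φ K : ℝ) * x u⌋,
    Nat.sub_pos_of_lt hlt, fun u => ?_⟩
  have h := (dist_le_pi_dist _ _ u).trans_lt (hK (K + 1) (by simp) K le_rfl)
  rw [Real.dist_eq] at h
  have h' : |((φ (K + 1) : ℝ) * x u - ⌊(φ (K + 1) : ℝ) * x u⌋) -
    ((φ K : ℝ) * x u - ⌊(φ K : ℝ) * x u⌋)| < ε := h
  rw [Nat.cast_sub hlt.le]
  push_cast
  rwa [show ((φ (K + 1) : ℝ) - φ K) * x u - (⌊(φ (K + 1) : ℝ) * x u⌋ - ⌊(φ K : ℝ) * x u⌋) =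
    ((φ (K + 1) : ℝ) * x u - ⌊(φ (K + 1) : ℝ) * x u⌋) -
      ((φ K : ℝ) * x u - ⌊(φ K : ℝ) * x u⌋) by ring]

/-- Simultaneous approximation that preserves integer linear equations. -/
theorem exists_int_solution_near [Finite ι] (A : ι → U → ℤ) (x : U → ℝ) (c : ι → ℤ)
    (hx : ∀ i, ∑ u, (A i u : ℝ) * x u = c i) {ε : ℝ} (hε : 0 < ε) :
    ∃ (N : ℕ) (m : U → ℤ), 0 < N ∧ (∀ u, |(N : ℝ) * x u - m u| < ε) ∧
      ∀ i, ∑ u, A i u * m u = N * c i := by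
  have := Fintype.ofFinite ι
  set C : ℝ := ∑ i, ∑ u, |(A i u : ℝ)| with hC
  have hC0 : 0 ≤ C := Finset.sum_nonneg fun _ _ => Finset.sum_nonneg fun _ _ => abs_nonneg _
  -- With this accuracy each row is off by less than `1`; being an integer, the error is zero.
  obtain ⟨N, m, hN, hm⟩ := exists_nat_mul_near_int x
    (ε := min ε (1 / (C + 1))) (lt_min hε (by positivity))
  refine ⟨N, m, hN, fun u => (hm u).trans_le (min_le_left _ _), fun i => ?_⟩
  have h1 : |(∑ u, (A i u : ℝ) * m u) - N * c i| < 1 := by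
    have h2 : (∑ u, (A i u : ℝ) * m u) - N * c i = -∑ u, (A i u : ℝ) * (N * x u - m u) := by
      rw [← hx i, Finset.mul_sum, ← Finset.sum_sub_distrib, ← Finset.sum_neg_distrib]
      exact Finset.sum_congr rfl fun u _ => by ring
    rw [h2, abs_neg]
    calc |∑ u, (A i u : ℝ) * (N * x u - m u)| ≤ ∑ u, |(A i u : ℝ) * (N * x u - m u)| :=
          Finset.abs_sum_le_sum_abs _ _
      _ ≤ ∑ u, |(A i u : ℝ)| * (1 / (C + 1)) := by
          refine Finset.sum_le_sum fun u _ => ?_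
          rw [abs_mul]
          gcongr
          exact (hm u).le.trans (min_le_right _ _)
      _ = (∑ u, |(A i u : ℝ)|) * (1 / (C + 1)) := by rw [Finset.sum_mul]
      _ ≤ C * (1 / (C + 1)) := by
          gcongr
          exact Finset.single_le_sum (f := fun i => ∑ u, |(A i u : ℝ)|)
            (fun _ _ => Finset.sum_nonneg fun _ _ => abs_nonneg _) (Finset.mem_univ i)
      _ < 1 := by
          rw [mul_one_div, div_lt_one (by linarith)]
          linarith
  have h3 : |(∑ u, A i u * m u) - N * c i| < 1 := by exact_mod_cast h1
  linarith [Int.abs_lt_one_iff.1 h3]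

/-- A real kernel vector of an integer matrix has a sign-compatible integer kernel vector. -/
theorem exists_int_kernel_sign_compatible [Finite ι] (A : ι → U → ℤ) (v : U → ℝ)
    (hA : ∀ i, ∑ u, (A i u : ℝ) * v u = 0) :
    ∃ m : U → ℤ, (∀ i, ∑ u, A i u * m u = 0) ∧
      ∀ u, (0 < v u → 0 < m u) ∧ (v u < 0 → m u < 0) ∧ (v u = 0 → m u = 0) := by
  classical
  -- Accuracy below the smallest nonzero `|v u|` preserves signs, and accuracy at most `1` forces
  -- zero entries to stay zero.
  obtain ⟨ε, hε, hε1, hv⟩ : ∃ ε : ℝ, 0 < ε ∧ ε ≤ 1 ∧ ∀ u, v u ≠ 0 → ε ≤ |v u| := by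
    by_cases hne : (Finset.univ.filter fun u => v u ≠ 0).Nonempty
    · obtain ⟨u₀, hu₀, hmin⟩ := Finset.exists_min_image _ (fun u => |v u|) hne
      refine ⟨min 1 |v u₀|, lt_min one_pos (abs_pos.2 (by simpa using hu₀)), min_le_left _ _,
        fun u hu => (min_le_right _ _).trans (hmin u (by simpa using hu))⟩
    · refine ⟨1, one_pos, le_rfl, fun u hu => (hne ⟨u, by simpa using hu⟩).elim⟩
  obtain ⟨N, m, hN, hm, hAm⟩ := exists_int_solution_near A v 0 (by simpa using hA) hε
  have hN1 : (1 : ℝ) ≤ N := by exact_mod_cast hN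
  refine ⟨m, fun i => by simpa using hAm i, fun u => ⟨fun h => ?_, fun h => ?_, fun h => ?_⟩⟩
  · have h1 := hv u h.ne'
    rw [abs_of_pos h] at h1
    have h2 := (abs_lt.1 (hm u)).2
    have : (0 : ℝ) < m u := by nlinarith
    exact_mod_cast this
  · have h1 := hv u h.ne
    rw [abs_of_neg h] at h1
    have h2 := (abs_lt.1 (hm u)).1
    have : (m u : ℝ) < 0 := by nlinarith
    exact_mod_cast this
  · have h1 := hm u
    rw [h] at h1
    simp only [mul_zero, zero_sub, abs_neg] at h1
    have h2 : |m u| < 1 := by exact_mod_cast h1.trans_le hε1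
    exact Int.abs_lt_one_iff.1 h2

/-- If the right-hand sides of integer systems, rescaled, converge to `A κ`, then the systems have
natural solutions which, rescaled, converge to `κ`, as soon as they have natural solutions. -/
theorem exists_nat_solutions_tendsto [Finite ι] (A : ι → U → ℤ) (κ : U → ℝ) (h0 : ∀ u, 0 ≤ κ u)
    (l : ℕ → ℕ) (hl : Tendsto l atTop atTop) (k : ℕ → U → ℕ)
    (hbd : ∀ n (k' : U → ℕ), (∀ i, ∑ u, A i u * (k' u : ℤ) = ∑ u, A i u * (k n u : ℤ)) →
      ∀ u, k' u ≤ l n)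
    (hlim : ∀ i, Tendsto (fun n => (∑ u, (A i u : ℝ) * k n u) / l n) atTop
      (𝓝 (∑ u, (A i u : ℝ) * κ u))) :
    ∃ k' : ℕ → U → ℕ, (∀ n i, ∑ u, A i u * (k' n u : ℤ) = ∑ u, A i u * (k n u : ℤ)) ∧
      ∀ u, Tendsto (fun n => (k' n u : ℝ) / l n) atTop (𝓝 (κ u)) := by
  classical
  -- Take the natural solution nearest to `l κ` in the `ℓ¹` norm; `hbd` leaves finitely many
  -- candidates.
  have hmin : ∀ n, ∃ k' : U → ℕ, (∀ i, ∑ u, A i u * (k' u : ℤ) = ∑ u, A i u * (k n u : ℤ)) ∧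
      ∀ k'' : U → ℕ, (∀ i, ∑ u, A i u * (k'' u : ℤ) = ∑ u, A i u * (k n u : ℤ)) →
        ∑ u, |(k' u : ℝ) - l n * κ u| ≤ ∑ u, |(k'' u : ℝ) - l n * κ u| := by
    intro n
    have hne : ((Fintype.piFinset fun _ : U => Finset.range (l n + 1)).filter fun k' : U → ℕ =>
        ∀ i, ∑ u, A i u * (k' u : ℤ) = ∑ u, A i u * (k n u : ℤ)).Nonempty :=
      ⟨k n, by
        simp only [Finset.mem_filter, Fintype.mem_piFinset, Finset.mem_range, implies_true,
          and_true]
        exact fun u => Nat.lt_succ_of_le (hbd n (k n) (fun _ => rfl) u)⟩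
    obtain ⟨k', hk', hm⟩ := Finset.exists_min_image _
      (fun k' : U → ℕ => ∑ u, |(k' u : ℝ) - l n * κ u|) hne
    refine ⟨k', (Finset.mem_filter.1 hk').2, fun k'' hk'' => hm k'' ?_⟩
    simp only [Finset.mem_filter, Fintype.mem_piFinset, Finset.mem_range]
    exact ⟨fun u => Nat.lt_succ_of_le (hbd n k'' hk'' u), hk''⟩
  choose k' hk' hk'min using hmin
  refine ⟨k', hk', fun u => (tendsto_pi_nhds.1 ?_ : ∀ u, Tendsto (fun n => (k' n u : ℝ) / l n) atTop
    (𝓝 (κ u))) u⟩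
  refine tendsto_of_subseq_tendsto fun ns hns => ?_
  have hmem : ∀ n, (fun u => (k' (ns n) u : ℝ) / l (ns n)) ∈
      Set.pi Set.univ fun _ : U => Set.Icc (0 : ℝ) 1 := by
    intro n u _
    refine ⟨by positivity, div_le_one_of_le₀ ?_ (by positivity)⟩
    exact_mod_cast hbd (ns n) (k' (ns n)) (hk' (ns n)) u
  obtain ⟨κ', hκ', φ, hφ, hlim'⟩ :=
    (isCompact_univ_pi fun _ : U => isCompact_Icc).tendsto_subseq hmem
  refine ⟨φ, ?_⟩
  set q : ℕ → ℕ := ns ∘ φ with hq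
  have hqt : Tendsto q atTop atTop := hns.comp hφ.tendsto_atTop
  have hlq : Tendsto (fun n => (l (q n) : ℝ)) atTop atTop :=
    tendsto_natCast_atTop_atTop.comp (hl.comp hqt)
  have hu : ∀ u, Tendsto (fun n => (k' (q n) u : ℝ) / l (q n)) atTop (𝓝 (κ' u)) :=
    fun u => (tendsto_pi_nhds.1 hlim') u
  suffices h : κ' = κ by
    rw [← h]
    exact hlim'
  -- Both limits satisfy the same equations, so their difference is a kernel vector. Subtracting its
  -- integer companion `m` from far-out solutions keeps them natural and lowers the `ℓ¹` distance by
  -- `∑ |m u|`, against minimality.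
  obtain ⟨m, hAm, hm⟩ := exists_int_kernel_sign_compatible A (fun u => κ' u - κ u) (by
    intro i
    have h1 : Tendsto (fun n => ∑ u, (A i u : ℝ) * ((k' (q n) u : ℝ) / l (q n))) atTop
        (𝓝 (∑ u, (A i u : ℝ) * κ' u)) :=
      tendsto_finsetSum _ fun u _ => (hu u).const_mul _
    have h2 := (hlim i).comp hqt
    have h3 : (fun n => ∑ u, (A i u : ℝ) * ((k' (q n) u : ℝ) / l (q n))) =
        (fun n => (∑ u, (A i u : ℝ) * k n u) / l n) ∘ q := by
      funext n
      have := hk' (q n) i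
      have h4 : ∑ u, (A i u : ℝ) * k' (q n) u = ∑ u, (A i u : ℝ) * k (q n) u := by
        exact_mod_cast this
      simp only [Function.comp, ← h4, Finset.sum_div, mul_div_assoc]
    rw [← h3] at h2
    have := tendsto_nhds_unique h1 h2
    simp only [mul_sub, Finset.sum_sub_distrib, this, sub_self])
  by_contra hne
  obtain ⟨u₀, hu₀⟩ := Function.ne_iff.1 hne
  -- far out, every coordinate is away from `l κ` by more than `m` where `m` does not vanish
  have hfar : ∀ u, Tendsto (fun n => (k' (q n) u : ℝ) / l (q n) - κ u) atTop
      (𝓝 (κ' u - κ u)) := fun u => (hu u).sub_const _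
  have hev : ∀ u, ∀ᶠ n in atTop,
      |(k' (q n) u : ℝ) - m u - l (q n) * κ u| = |(k' (q n) u : ℝ) - l (q n) * κ u| - |(m u : ℝ)| ∧
      (m u : ℤ) ≤ k' (q n) u := by
    intro u
    have hdiv : ∀ᶠ n in atTop, (k' (q n) u : ℝ) - l (q n) * κ u =
        l (q n) * ((k' (q n) u : ℝ) / l (q n) - κ u) := by
      filter_upwards [hlq.eventually_gt_atTop 0] with n hn
      field_simp
    rcases lt_trichotomy (κ' u - κ u) 0 with h | h | h
    · have hm1 := (hm u).2.1 h
      have ht := hlq.atTop_mul_neg h (hfar u)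
      filter_upwards [hdiv, ht.eventually_le_atBot (m u : ℝ)] with n hn1 hn2
      rw [← hn1] at hn2
      have hm2 : (m u : ℝ) < 0 := by exact_mod_cast hm1
      refine ⟨?_, by omega⟩
      rw [abs_of_nonpos (by linarith), abs_of_neg (by linarith), abs_of_neg hm2]
      ring
    · have hm1 := (hm u).2.2 h
      simp [hm1]
    · have hm1 := (hm u).1 h
      have ht := hlq.atTop_mul_pos h (hfar u)
      filter_upwards [hdiv, ht.eventually_ge_atTop (m u : ℝ)] with n hn1 hn2
      rw [← hn1] at hn2
      have hm2 : (0 : ℝ) < m u := by exact_mod_cast hm1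
      have h5 : 0 ≤ (l (q n) : ℝ) * κ u := mul_nonneg (Nat.cast_nonneg _) (h0 u)
      refine ⟨?_, ?_⟩
      · rw [abs_of_nonneg (by linarith), abs_of_pos (by linarith), abs_of_pos hm2]
        ring
      · have : (m u : ℝ) ≤ (k' (q n) u : ℕ) := by linarith
        exact_mod_cast this
  obtain ⟨n, hn⟩ := (eventually_all.2 hev).exists
  have hcast : ∀ u, (((k' (q n) u - m u : ℤ).toNat : ℕ) : ℤ) = k' (q n) u - m u :=
    fun u => Int.toNat_of_nonneg (by linarith [(hn u).2])
  have hcastR : ∀ u, (((k' (q n) u - m u : ℤ).toNat : ℕ) : ℝ) = k' (q n) u - m u :=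
    fun u => by exact_mod_cast congrArg (Int.cast : ℤ → ℝ) (hcast u)
  have hle := hk'min (q n) (fun u => (k' (q n) u - m u : ℤ).toNat) (fun i => by
    simp only [hcast, mul_sub, Finset.sum_sub_distrib, hAm i, sub_zero]
    exact hk' (q n) i)
  simp only [hcastR, (hn _).1, Finset.sum_sub_distrib] at hle
  have hpos : 0 < ∑ u, |(m u : ℝ)| := by
    refine Finset.sum_pos' (fun _ _ => abs_nonneg _) ⟨u₀, Finset.mem_univ _, abs_pos.2 ?_⟩
    have : m u₀ ≠ 0 := by
      rcases lt_or_gt_of_ne (sub_ne_zero.2 hu₀) with h | h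
      · exact ((hm u₀).2.1 h).ne
      · exact ((hm u₀).1 h).ne'
    exact_mod_cast this
  linarith

/-- Fredholm alternative in coordinates. -/
theorem mem_submodule_of_forall_sum_mul_eq_zero (W : Submodule ℝ (U → ℝ)) (x : U → ℝ)
    (h : ∀ η : U → ℝ, (∀ w ∈ W, ∑ u, η u * w u = 0) → ∑ u, η u * x u = 0) : x ∈ W := by
  classical
  by_contra hx
  obtain ⟨f, hf, hW⟩ := Submodule.exists_le_ker_of_notMem hx
  have hrep : ∀ y : U → ℝ, ∑ u, f (Pi.single u 1) * y u = f y := by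
    intro y
    conv_rhs => rw [pi_eq_sum_univ' y]
    rw [map_sum]
    refine Finset.sum_congr rfl fun u _ => ?_
    rw [map_smul, smul_eq_mul, mul_comm]
  refine hf ?_
  rw [← hrep x]
  refine h _ fun w hw => ?_
  rw [hrep]
  exact hW hw

end IntegerPoints

/-! ### Factorial estimates and counting of rearrangements -/

section Counting

theorem abs_log_factorial_sub_le (n : ℕ) :
    |Real.log (n.factorial : ℝ) - (n * Real.log n - n)| ≤ 1 + Real.log (n + 1) := by
  have hlow : (n : ℝ) * Real.log n - n ≤ Real.log (n.factorial : ℝ) := by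
    rcases n.eq_zero_or_pos with rfl | hn
    · simp
    have hn' : (0 : ℝ) < n := by exact_mod_cast hn
    have h := Real.pow_div_factorial_le_exp (n : ℝ) hn'.le n
    have hf : (0 : ℝ) < n.factorial := by exact_mod_cast n.factorial_pos
    have h2 := Real.log_le_log (by positivity) h
    rw [Real.log_exp, Real.log_div (by positivity) hf.ne', Real.log_pow] at h2
    linarith
  have hup : Real.log (n.factorial : ℝ) ≤ n * Real.log n - n + 1 + Real.log (n + 1) := by
    have aux : ∀ m : ℕ, Real.log ((m + 1).factorial : ℝ) ≤
        (m + 1 : ℝ) * Real.log (m + 1) - (m + 1) + 1 + Real.log (m + 1) := by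
      intro m
      induction m with
      | zero => simp
      | succ m ih =>
        have hm : (0 : ℝ) < m + 1 := by positivity
        rw [Nat.factorial_succ, Nat.cast_mul, Real.log_mul (by positivity) (by positivity)]
        push_cast
        -- The induction step amounts to `(m + 2) * log ((m + 2) / (m + 1)) ≥ 1`.
        have h1 := Real.one_sub_inv_le_log_of_pos (x := ((m : ℝ) + 1 + 1) / (m + 1)) (by positivity)
        rw [Real.log_div (by positivity) hm.ne', inv_div] at h1
        have h2 : 1 - ((m : ℝ) + 1) / (m + 1 + 1) = 1 / (m + 1 + 1) := by field_simp; ring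
        rw [h2] at h1
        have h3 := mul_le_mul_of_nonneg_left h1 (show (0 : ℝ) ≤ m + 1 + 1 by positivity)
        rw [mul_one_div, div_self (by positivity)] at h3
        nlinarith
    rcases n with _ | m
    · simp
    have h1 := aux m
    push_cast at h1 ⊢
    have h2 : Real.log ((m : ℝ) + 1) ≤ Real.log (m + 1 + 1) :=
      Real.log_le_log (by positivity) (by linarith)
    linarith
  have h3 : 0 ≤ Real.log ((n : ℝ) + 1) := Real.log_nonneg (by linarith [n.cast_nonneg (α := ℝ)])
  rw [abs_le]
  constructor <;> linarith

/-- Entropy estimate for multinomial coefficients. -/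
theorem abs_log_factorial_sub_sum_sub_le {U : Type*} [Fintype U] (k : U → ℕ) {l : ℕ}
    (hk : ∑ u, k u = l) :
    |Real.log (l.factorial : ℝ) - ∑ u, Real.log ((k u).factorial : ℝ) -
      l * ∑ u, Real.negMulLog ((k u : ℝ) / l)| ≤
      ((Fintype.card U : ℝ) + 1) * (1 + Real.log (l + 1)) := by
  have hkl : ∀ u, k u ≤ l := fun u => by
    rw [← hk]
    exact Finset.single_le_sum (f := k) (fun _ _ => Nat.zero_le _) (Finset.mem_univ u)
  have hkR : ∑ u, (k u : ℝ) = l := by exact_mod_cast hk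
  have hent : (l : ℝ) * ∑ u, Real.negMulLog ((k u : ℝ) / l) =
      l * Real.log l - ∑ u, (k u : ℝ) * Real.log (k u) := by
    rcases l.eq_zero_or_pos with rfl | hl
    · have : ∀ u, k u = 0 := fun u => Nat.le_zero.1 (hkl u)
      simp [this]
    have hl' : (0 : ℝ) < l := by exact_mod_cast hl
    have h1 : ∀ u, (l : ℝ) * Real.negMulLog ((k u : ℝ) / l) =
        (k u : ℝ) * Real.log l - k u * Real.log (k u) := by
      intro u
      rcases (k u).eq_zero_or_pos with h | h
      · simp [h]
      have h' : (0 : ℝ) < k u := by exact_mod_cast h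
      rw [Real.negMulLog, Real.log_div h'.ne' hl'.ne']
      field_simp
      ring
    rw [Finset.mul_sum]
    simp only [h1, Finset.sum_sub_distrib, ← Finset.sum_mul, hkR]
  have hid : Real.log (l.factorial : ℝ) - ∑ u, Real.log ((k u).factorial : ℝ) -
      l * ∑ u, Real.negMulLog ((k u : ℝ) / l) =
      (Real.log (l.factorial : ℝ) - (l * Real.log l - l)) -
        ∑ u, (Real.log ((k u).factorial : ℝ) - (k u * Real.log (k u) - k u)) := by
    rw [hent]
    simp only [Finset.sum_sub_distrib, hkR]
    ring
  rw [hid]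
  calc _ ≤ |Real.log (l.factorial : ℝ) - (l * Real.log l - l)| +
        |∑ u, (Real.log ((k u).factorial : ℝ) - (k u * Real.log (k u) - k u))| := abs_sub _ _
    _ ≤ (1 + Real.log (l + 1)) + ∑ u : U, (1 + Real.log ((l : ℝ) + 1)) := by
        refine add_le_add (abs_log_factorial_sub_le l) ((Finset.abs_sum_le_sum_abs _ _).trans ?_)
        refine Finset.sum_le_sum fun u _ => (abs_log_factorial_sub_le (k u)).trans ?_
        have : (k u : ℝ) ≤ l := by exact_mod_cast hkl u
        gcongr
    _ = _ := by
        rw [Finset.sum_const, Finset.card_univ, nsmul_eq_mul]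
        ring

theorem abs_log_choose_sub_le {l w : ℕ} (hw : w ≤ l) :
    |Real.log (l.choose w : ℝ) - l * Real.binEntropy ((w : ℝ) / l)| ≤
      3 * (1 + Real.log (l + 1)) := by
  have h := abs_log_factorial_sub_sum_sub_le (fun b : Bool => if b then w else l - w) (l := l)
    (by simp; omega)
  simp only [Fintype.sum_bool, if_true, Bool.false_eq_true, if_false, Fintype.card_bool] at h
  have h1 : Real.binEntropy ((w : ℝ) / l) * l =
      (Real.negMulLog ((w : ℝ) / l) + Real.negMulLog (((l - w : ℕ) : ℝ) / l)) * l := by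
    rcases l.eq_zero_or_pos with rfl | hl
    · simp
    have hl' : (l : ℝ) ≠ 0 := by positivity
    rw [Real.binEntropy_eq_negMulLog_add_negMulLog_one_sub, Nat.cast_sub hw, sub_div, div_self hl']
  have h2 : Real.log (l.choose w : ℝ) = Real.log (l.factorial : ℝ) -
      (Real.log (w.factorial : ℝ) + Real.log ((l - w).factorial : ℝ)) := by
    rw [Nat.cast_choose ℝ hw, Real.log_div (by positivity) (by positivity),
      Real.log_mul (by positivity) (by positivity)]
  rw [h2, mul_comm, h1, mul_comm]
  convert h using 2
  norm_num

/-- The permutations carrying one function to another with the same fibre sizes. -/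
theorem card_perm_comp_eq {α T : Type*} [Fintype α] [DecidableEq α] [Fintype T] [DecidableEq T]
    (f y : α → T) :
    (Finset.univ.filter fun σ : Equiv.Perm α => ∀ t, f (σ t) = y t).card =
      if ∀ u, (Finset.univ.filter fun t => y t = u).card =
        (Finset.univ.filter fun t => f t = u).card
      then ∏ u, ((Finset.univ.filter fun t => f t = u).card).factorial else 0 := by
  by_cases hσ : ∃ σ : Equiv.Perm α, ∀ t, f (σ t) = y t
  · obtain ⟨σ, hσ⟩ := hσ
    have hcard : ∀ u, (Finset.univ.filter fun t => y t = u).card =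
        (Finset.univ.filter fun t => f t = u).card := by
      intro u
      refine Finset.card_bij (fun t _ => σ t) ?_ ?_ ?_
      · intro t ht
        simpa [hσ] using ht
      · intro a _ b _ h
        exact σ.injective h
      · intro b hb
        refine ⟨σ.symm b, ?_, by simp⟩
        simpa [← hσ] using hb
    rw [if_pos hcard]
    -- Once one `σ` works, all solutions form a coset of the stabiliser of `f`, whose order is the
    -- product of the factorials of the fibre sizes.
    have h := DomMulAct.stabilizer_card (f := f)
    simp only [Fintype.card_subtype] at h
    rw [← h]
    refine Finset.card_bij (fun τ _ => τ * σ⁻¹) ?_ ?_ ?_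
    · intro τ hτ
      simp only [Finset.mem_filter, Finset.mem_univ, true_and] at hτ ⊢
      funext t
      simp only [Function.comp, Equiv.Perm.mul_apply]
      rw [hτ, ← hσ]
      simp
    · intro a _ b _ hab
      exact mul_right_cancel hab
    · intro τ hτ
      simp only [Finset.mem_filter, Finset.mem_univ, true_and] at hτ
      refine ⟨τ * σ, ?_, by simp⟩
      simp only [Finset.mem_filter, Finset.mem_univ, true_and, Equiv.Perm.mul_apply]
      intro t
      rw [← hσ t]
      exact congrFun hτ (σ t)
  · rw [if_neg, Finset.card_eq_zero, Finset.filter_eq_empty_iff]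
    · exact fun σ _ h => hσ ⟨σ, h⟩
    · intro hcard
      refine hσ ?_
      have e : ∀ u, Nonempty ({t // y t = u} ≃ {t // f t = u}) := fun u =>
        ⟨Fintype.equivOfCardEq (by simpa only [Fintype.card_subtype] using hcard u)⟩
      exact ⟨Equiv.ofFiberEquiv fun u => (e u).some, fun t => Equiv.ofFiberEquiv_map _ t⟩

/-- The number of words with prescribed letter counts, up to the inequality that is needed. -/
theorem factorial_le_card_mul_prod_factorial {T : Type*} [Fintype T] [DecidableEq T] {l : ℕ}
    (k : T → ℕ) (hk : ∑ u, k u = l) :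
    l.factorial ≤ (Finset.univ.filter fun y : Fin l → T =>
      ∀ u, (Finset.univ.filter fun t => y t = u).card = k u).card * ∏ u, (k u).factorial := by
  have hcard : Fintype.card (Fin l) = Fintype.card (Σ u, Fin (k u)) := by simp [hk]
  let e := Fintype.equivOfCardEq hcard
  set f : Fin l → T := fun t => (e t).1 with hf
  have hfk : ∀ u, (Finset.univ.filter fun t => f t = u).card = k u := by
    intro u
    rw [← Fintype.card_subtype]
    rw [Fintype.card_congr ((e.subtypeEquiv (q := fun x : Σ u, Fin (k u) => x.1 = u)
      fun t => Iff.rfl).trans (Equiv.sigmaSubtype u)), Fintype.card_fin]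
  -- Sort the permutations by the rearrangement of the sample word `f` that they produce; each fibre
  -- has at most `∏ u, (k u)!` elements.
  have h := Finset.card_eq_sum_card_fiberwise (s := (Finset.univ : Finset (Equiv.Perm (Fin l))))
    (f := fun σ t => f (σ t)) (t := Finset.univ.filter fun y : Fin l → T =>
      ∀ u, (Finset.univ.filter fun t => y t = u).card = k u) (by
      intro σ _
      simp only [Finset.coe_filter, Finset.mem_univ, true_and, Set.mem_ofPred_eq]
      intro u
      rw [← hfk u]
      refine Finset.card_bij (fun t _ => σ t) ?_ ?_ ?_
      · intro t ht
        simpa using ht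
      · intro a _ b _ h
        exact σ.injective h
      · intro b hb
        exact ⟨σ.symm b, by simpa using hb, by simp⟩)
  rw [Finset.card_univ, Fintype.card_perm, Fintype.card_fin] at h
  rw [h, Finset.card_eq_sum_ones, Finset.sum_mul]
  refine Finset.sum_le_sum fun y _ => ?_
  have h2 := card_perm_comp_eq f y
  simp only [hfk] at h2
  rw [one_mul]
  refine (Eq.le (?_ : _ = _)).trans (h2.le.trans ?_)
  · congr 1
    ext σ
    simp [funext_iff]
  · split_ifs <;> simp

end Counting

namespace Protograph

/-! ### The exponent as a function of the weights, and existence of optimal weights -/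

section Exponent

variable {h₀ n₀ : ℕ} {E : Type*} [Fintype E]

/-- Averaging the expansions of the two products cancels the odd subsets, which is the parity
condition at one check. -/
theorem S_eq_sum (P : Protograph h₀ n₀ E) (i : Fin n₀) (z : E → ℝ) :
    P.S i z = ∑ c ∈ (P.edgesC i).powerset.filter fun c => Even c.card, ∏ g ∈ c, z g := by
  have h : ∀ g, 1 - z g = 1 + -z g := fun g => sub_eq_add_neg _ _
  simp only [S, h, Finset.prod_one_add, Finset.prod_neg]
  rw [← Finset.sum_add_distrib, Finset.mul_sum, Finset.sum_filter]
  refine Finset.sum_congr rfl fun c _ => ?_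
  split_ifs with hc
  · rw [hc.neg_one_pow]
    ring
  · rw [(Nat.not_even_iff_odd.1 hc).neg_one_pow]
    ring

theorem sum_edgesV (P : Protograph h₀ n₀ E) (f : (Fin h₀ ⊕ Fin n₀) → ℝ) (s : E → ℝ) :
    ∑ j, f j * ∑ g ∈ P.edgesV j, s g = ∑ g, f (P.vn g) * s g := by
  rw [← Finset.sum_fiberwise Finset.univ P.vn fun g => f (P.vn g) * s g]
  refine Finset.sum_congr rfl fun j _ => ?_
  rw [Finset.mul_sum, edgesV]
  refine Finset.sum_congr rfl fun g hg => ?_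
  rw [(Finset.mem_filter.1 hg).2]

/-- The contribution of the variable nodes to the exponent. -/
noncomputable def entropyV (P : Protograph h₀ n₀ E) (δ : Fin h₀ ⊕ Fin n₀ → ℝ) : ℝ :=
  ∑ j, ((P.degV j : ℝ) - 1) / n₀ * Real.binEntropy (n₀ * δ j)

theorem continuous_entropyV (P : Protograph h₀ n₀ E) : Continuous P.entropyV := by
  unfold entropyV
  have := Real.binEntropy_continuous
  fun_prop

theorem continuous_Gexpr (P : Protograph h₀ n₀ E) (z : E → ℝ) : Continuous (P.Gexpr z) := by
  unfold Gexpr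
  have := Real.binEntropy_continuous
  fun_prop

theorem J_le (P : Protograph h₀ n₀ E) {z : E → ℝ} (hz : ∀ g, 0 < z g)
    (δ : Fin h₀ ⊕ Fin n₀ → ℝ) : P.J δ ≤ (P.Gexpr z δ : EReal) :=
  iInf₂_le z hz

/-- An infimum of functions continuous in `δ`. Together with compactness of `weights` this yields a
maximiser even though the value `⊥` may occur. -/
theorem upperSemicontinuous_J (P : Protograph h₀ n₀ E) : UpperSemicontinuous P.J :=
  upperSemicontinuous_biInf fun z _ =>
    (continuous_coe_real_ereal.comp (P.continuous_Gexpr z)).upperSemicontinuous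

theorem S_pos (P : Protograph h₀ n₀ E) (i : Fin n₀) {z : E → ℝ} (hz : ∀ g, 0 < z g) :
    0 < P.S i z := by
  rw [S_eq_sum]
  exact Finset.sum_pos (fun c _ => Finset.prod_pos fun g _ => hz g) ⟨∅, by simp⟩

theorem weights_nonempty (hn : 0 < n₀) {α β : ℝ} (hα : 0 ≤ α ∧ α ≤ (h₀ : ℝ) / n₀)
    (hβ : 0 ≤ β ∧ β ≤ 1) : (weights h₀ n₀ α β).Nonempty := by
  have hn' : (0 : ℝ) < n₀ := by exact_mod_cast hn
  refine ⟨Sum.elim (fun _ => α / h₀) fun _ => β / n₀, ?_, ?_, ?_⟩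
  · rintro (j | j)
    · have hh : (0 : ℝ) < h₀ := by exact_mod_cast j.pos
      refine ⟨div_nonneg hα.1 hh.le, ?_⟩
      rw [Sum.elim_inl, div_le_iff₀ hh]
      calc α ≤ h₀ / n₀ := hα.2
        _ = 1 / n₀ * h₀ := by ring
    · refine ⟨div_nonneg hβ.1 hn'.le, ?_⟩
      rw [Sum.elim_inr]
      gcongr
      exact hβ.2
  -- Without punctured nodes the bound on `α` forces `α = 0`, so the empty sum is correct.
  · rcases h₀.eq_zero_or_pos with rfl | hh
    · simp only [Nat.cast_zero, zero_div] at hα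
      simp [le_antisymm hα.2 hα.1]
    · have : (h₀ : ℝ) ≠ 0 := by positivity
      simp only [Sum.elim_inl, Finset.sum_const, Finset.card_univ, Fintype.card_fin, nsmul_eq_mul]
      field_simp
  · simp only [Sum.elim_inr, Finset.sum_const, Finset.card_univ, Fintype.card_fin, nsmul_eq_mul]
    field_simp

theorem isCompact_weights (α β : ℝ) : IsCompact (weights h₀ n₀ α β) := by
  refine (isCompact_univ_pi fun _ : Fin h₀ ⊕ Fin n₀ =>
    isCompact_Icc (a := (0 : ℝ)) (b := 1 / (n₀ : ℝ))).of_isClosed_subset ?_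
    fun δ hδ j _ => hδ.1 j
  have h1 : IsClosed {δ : Fin h₀ ⊕ Fin n₀ → ℝ | ∀ j, 0 ≤ δ j ∧ δ j ≤ 1 / (n₀ : ℝ)} := by
    simp only [Set.ofPred_forall]
    refine isClosed_iInter fun j => ?_
    exact (isClosed_le continuous_const (continuous_apply j)).inter
      (isClosed_le (continuous_apply j) continuous_const)
  have h2 : IsClosed {δ : Fin h₀ ⊕ Fin n₀ → ℝ | ∑ j, δ (Sum.inl j) = α} :=
    isClosed_eq (by fun_prop) continuous_const
  have h3 : IsClosed {δ : Fin h₀ ⊕ Fin n₀ → ℝ | ∑ j, δ (Sum.inr j) = β} :=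
    isClosed_eq (by fun_prop) continuous_const
  exact h1.inter (h2.inter h3)

theorem exists_isOptimal (hn : 0 < n₀) (P : Protograph h₀ n₀ E) {α β : ℝ}
    (hα : 0 ≤ α ∧ α ≤ (h₀ : ℝ) / n₀) (hβ : 0 ≤ β ∧ β ≤ 1) : ∃ δ, P.IsOptimal α β δ := by
  obtain ⟨δ, hδ, hmax⟩ := UpperSemicontinuousOn.exists_isMaxOn (weights_nonempty hn hα hβ)
    (isCompact_weights α β) (P.upperSemicontinuous_J.upperSemicontinuousOn _)
  exact ⟨δ, hδ, hmax⟩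

end Exponent

/-! ### Configurations and the dual form of the exponent -/

section Configurations

variable {h₀ n₀ : ℕ} {E : Type*} [Fintype E] [DecidableEq E]

/-- Sets of edges that meet every check node an even number of times. -/
abbrev Config (P : Protograph h₀ n₀ E) : Type _ :=
  {u : Finset E // ∀ i, Even (u ∩ P.edgesC i).card}

instance (P : Protograph h₀ n₀ E) : Nonempty P.Config := ⟨⟨∅, by simp⟩⟩

/-- Incidence of configurations and edges. -/
def incidence (P : Protograph h₀ n₀ E) (u : P.Config) (g : E) : ℝ := if g ∈ u.1 then 1 else 0

/-- Each edge lies at exactly one check, so a configuration is the same as an independent choice of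
an even edge set at every check. -/
theorem prod_S (P : Protograph h₀ n₀ E) (z : E → ℝ) :
    ∏ i, P.S i z = ∑ u : P.Config, ∏ g ∈ u.1, z g := by
  simp only [S_eq_sum, Finset.prod_univ_sum]
  refine Finset.sum_bij' (fun c hc => ⟨Finset.univ.biUnion c, ?_⟩)
    (fun u _ i => u.1 ∩ P.edgesC i) ?_ ?_ ?_ ?_ ?_
  · intro i
    simp only [Fintype.mem_piFinset, Finset.mem_filter, Finset.mem_powerset] at hc
    have : Finset.univ.biUnion c ∩ P.edgesC i = c i := by
      ext g
      simp only [Finset.mem_inter, Finset.mem_biUnion, Finset.mem_univ, true_and]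
      constructor
      · rintro ⟨⟨i', hi'⟩, hi⟩
        have h1 := (hc i').1 hi'
        simp only [edgesC, Finset.mem_filter, Finset.mem_univ, true_and] at h1 hi
        rwa [← hi, h1]
      · exact fun hg => ⟨⟨i, hg⟩, (hc i).1 hg⟩
    rw [this]
    exact (hc i).2
  · intro c _
    exact Finset.mem_univ _
  · intro u _
    simp only [Fintype.mem_piFinset, Finset.mem_filter, Finset.mem_powerset]
    exact fun i => ⟨Finset.inter_subset_right, u.2 i⟩
  · intro c hc
    simp only [Fintype.mem_piFinset, Finset.mem_filter, Finset.mem_powerset] at hc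
    funext i
    ext g
    simp only [Finset.mem_inter, Finset.mem_biUnion, Finset.mem_univ, true_and]
    constructor
    · rintro ⟨⟨i', hi'⟩, hi⟩
      have h1 := (hc i').1 hi'
      simp only [edgesC, Finset.mem_filter, Finset.mem_univ, true_and] at h1 hi
      rwa [← hi, h1]
    · exact fun hg => ⟨⟨i, hg⟩, (hc i).1 hg⟩
  · intro u _
    refine Subtype.ext ?_
    ext g
    simp [edgesC]
  · intro c hc
    simp only [Fintype.mem_piFinset, Finset.mem_filter, Finset.mem_powerset] at hc
    rw [Finset.prod_biUnion]
    intro i _ i' _ hne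
    refine Finset.disjoint_left.2 fun g hg hg' => hne ?_
    have h1 := (hc i).1 hg
    have h2 := (hc i').1 hg'
    simp only [edgesC, Finset.mem_filter, Finset.mem_univ, true_and] at h1 h2
    rw [← h1, h2]

theorem prod_eq_exp (P : Protograph h₀ n₀ E) {z : E → ℝ} (hz : ∀ g, 0 < z g) (u : P.Config) :
    ∏ g ∈ u.1, z g = Real.exp (∑ g, P.incidence u g * Real.log (z g)) := by
  simp only [incidence, ite_mul, one_mul, zero_mul, Finset.sum_ite_mem, Finset.univ_inter]
  rw [Real.exp_sum]
  exact Finset.prod_congr rfl fun g _ => (Real.exp_log (hz g)).symm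

theorem sum_log_S (P : Protograph h₀ n₀ E) {z : E → ℝ} (hz : ∀ g, 0 < z g) :
    ∑ i, Real.log (P.S i z) = logPartition P.incidence fun g => Real.log (z g) := by
  rw [← Real.log_prod fun i _ => (P.S_pos i hz).ne', prod_S, logPartition]
  simp only [P.prod_eq_exp hz]

/-- Grouping edges by variable node exhibits the explicit expression as the maximum entropy dual
objective for the marginals `n₀ δ` at `s = log z`; the identity lets the duality lemmas apply. -/
theorem Gexpr_eq (hn : 0 < n₀) (P : Protograph h₀ n₀ E) {z : E → ℝ} (hz : ∀ g, 0 < z g)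
    (δ : Fin h₀ ⊕ Fin n₀ → ℝ) :
    P.Gexpr z δ = 1 / (n₀ : ℝ) * (logPartition P.incidence (fun g => Real.log (z g)) -
      ∑ g, n₀ * δ (P.vn g) * Real.log (z g)) - P.entropyV δ := by
  have hn' : (n₀ : ℝ) ≠ 0 := by positivity
  simp only [Gexpr, P.sum_log_S hz, Finset.sum_add_distrib, P.sum_edgesV, entropyV, mul_assoc,
    ← Finset.mul_sum]
  field_simp
  ring

/-- Any distribution on configurations with the right marginals bounds the exponent below. -/
theorem entropy_le_J (hn : 0 < n₀) (P : Protograph h₀ n₀ E) (δ : Fin h₀ ⊕ Fin n₀ → ℝ)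
    (κ : P.Config → ℝ) (h0 : ∀ u, 0 ≤ κ u) (h1 : ∑ u, κ u = 1)
    (hκ : ∀ g, ∑ u, κ u * P.incidence u g = n₀ * δ (P.vn g)) :
    ((1 / (n₀ : ℝ) * ∑ u, Real.negMulLog (κ u) - P.entropyV δ : ℝ) : EReal) ≤ P.J δ := by
  refine le_iInf₂ fun z hz => ?_
  rw [EReal.coe_le_coe_iff, P.Gexpr_eq hn hz]
  have := sum_negMulLog_le_logPartition P.incidence (fun g => Real.log (z g)) _ κ h0 h1 hκ
  gcongr

/-- Some distribution on configurations with the right marginals attains the exponent. -/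
theorem exists_entropy_ge (hn : 0 < n₀) (P : Protograph h₀ n₀ E) (δ : Fin h₀ ⊕ Fin n₀ → ℝ)
    (G : ℝ) (hG : (G : EReal) ≤ P.J δ) :
    ∃ κ : P.Config → ℝ, (∀ u, 0 ≤ κ u) ∧ ∑ u, κ u = 1 ∧
      (∀ g, ∑ u, κ u * P.incidence u g = n₀ * δ (P.vn g)) ∧
      G ≤ 1 / (n₀ : ℝ) * ∑ u, Real.negMulLog (κ u) - P.entropyV δ := by
  have hn' : (0 : ℝ) < n₀ := by exact_mod_cast hn
  obtain ⟨κ, h0, h1, hm, hB⟩ := exists_marginals_entropy_ge P.incidence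
    (fun g => n₀ * δ (P.vn g)) (n₀ * (G + P.entropyV δ)) (by
      intro s
      have hz : ∀ g, 0 < Real.exp (s g) := fun g => Real.exp_pos _
      have h := hG.trans (P.J_le hz δ)
      rw [EReal.coe_le_coe_iff, P.Gexpr_eq hn hz] at h
      simp only [Real.log_exp] at h
      rw [← le_div_iff₀' hn']
      rw [one_div_mul_eq_div] at h
      linarith)
  refine ⟨κ, h0, h1, hm, ?_⟩
  rw [← le_div_iff₀' hn'] at hB
  rw [one_div_mul_eq_div]
  linarith

/-- The saddle-point equations prescribe the marginals of the Gibbs distribution. -/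
theorem mul_deriv_log_S (P : Protograph h₀ n₀ E) {z : E → ℝ} (hz : ∀ g, 0 < z g) (g : E) :
    z g * deriv (fun t => Real.log (P.S (P.cn g) (Function.update z g t))) (z g) =
      ∑ u, gibbsWeight P.incidence (fun g => Real.log (z g)) u * P.incidence u g := by
  have hupd : ∀ t, 0 < t → ∀ g', 0 < Function.update z g t g' := by
    intro t ht g'
    by_cases h : g' = g
    · subst h
      simpa
    · simpa [h] using hz g'
  have hconst : ∀ i, i ≠ P.cn g → ∀ t, P.S i (Function.update z g t) = P.S i z := by
    intro i hi t
    have hg : g ∉ P.edgesC i := by simpa [edgesC] using hi.symm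
    unfold S
    congr 2 <;> refine Finset.prod_congr rfl fun g' hg' => ?_ <;>
      rw [Function.update_of_ne (ne_of_mem_of_not_mem hg' hg)]
  -- Only the check at the end of `g` sees `z g`, so locally its logarithm differs from the full
  -- log-partition function by a constant.
  have hev : (fun t => Real.log (P.S (P.cn g) (Function.update z g t))) =ᶠ[𝓝 (z g)]
      fun t => logPartition P.incidence
          (Function.update (fun g => Real.log (z g)) g (Real.log t)) -
        ∑ i ∈ Finset.univ.erase (P.cn g), Real.log (P.S i z) := by
    filter_upwards [lt_mem_nhds (hz g)] with t ht
    have h1 := P.sum_log_S (hupd t ht)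
    have h2 : (fun g' => Real.log (Function.update z g t g')) =
        Function.update (fun g => Real.log (z g)) g (Real.log t) := by
      funext g'
      by_cases h : g' = g
      · subst h
        simp
      · simp [h]
    rw [h2, ← Finset.add_sum_erase _ _ (Finset.mem_univ (P.cn g))] at h1
    rw [← h1, eq_sub_iff_add_eq, add_right_inj]
    refine Finset.sum_congr rfl fun i hi => ?_
    rw [hconst i (Finset.ne_of_mem_erase hi)]
  rw [hev.deriv_eq]
  have h3 := (hasDerivAt_logPartition P.incidence (fun g => Real.log (z g)) g).comp (z g)
    (Real.hasDerivAt_log (hz g).ne')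
  have h4 : HasDerivAt (fun t => logPartition P.incidence
      (Function.update (fun g => Real.log (z g)) g (Real.log t)) -
        ∑ i ∈ Finset.univ.erase (P.cn g), Real.log (P.S i z)) _ (z g) := h3.sub_const _
  rw [h4.deriv]
  field_simp [(hz g).ne']

theorem isSaddle_iff (P : Protograph h₀ n₀ E) (z : E → ℝ) (δ : Fin h₀ ⊕ Fin n₀ → ℝ) :
    P.IsSaddle z δ ↔ (∀ g, 0 < z g) ∧ ∀ g,
      ∑ u, gibbsWeight P.incidence (fun g => Real.log (z g)) u * P.incidence u g =
        n₀ * δ (P.vn g) := by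
  refine and_congr_right fun hz => forall_congr' fun g => ?_
  rw [P.mul_deriv_log_S hz]

theorem Gexpr_eq_entropy (hn : 0 < n₀) (P : Protograph h₀ n₀ E) {z : E → ℝ}
    {δ : Fin h₀ ⊕ Fin n₀ → ℝ} (h : P.IsSaddle z δ) :
    P.Gexpr z δ = 1 / (n₀ : ℝ) * ∑ u, Real.negMulLog
      (gibbsWeight P.incidence (fun g => Real.log (z g)) u) - P.entropyV δ := by
  obtain ⟨hz, hm⟩ := (P.isSaddle_iff z δ).1 h
  rw [P.Gexpr_eq hn hz, sum_negMulLog_gibbsWeight _ _ _ hm]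

/-- The infimum bounds from one side. From the other, the Gibbs distribution of `z` is feasible by
the saddle-point equations, and its entropy reproduces the expression. -/
theorem J_eq_of_isSaddle (hn : 0 < n₀) (P : Protograph h₀ n₀ E) {z : E → ℝ}
    {δ : Fin h₀ ⊕ Fin n₀ → ℝ} (h : P.IsSaddle z δ) : P.J δ = (P.Gexpr z δ : EReal) := by
  refine le_antisymm (P.J_le h.1 δ) ?_
  rw [P.Gexpr_eq_entropy hn h]
  exact P.entropy_le_J hn δ _ (fun u => (gibbsWeight_pos _ _ u).le) (sum_gibbsWeight _ _)
    ((P.isSaddle_iff z δ).1 h).2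

end Configurations

end Protograph

/-! ### Exact averaging over the edge permutations -/

theorem card_perm_iff {l : ℕ} (p q : Fin l → Prop) [DecidablePred p] [DecidablePred q] :
    (Finset.univ.filter fun σ : Equiv.Perm (Fin l) => ∀ t, p (σ t) ↔ q t).card =
      if (Finset.univ.filter q).card = (Finset.univ.filter p).card
      then ((Finset.univ.filter p).card).factorial * (l - (Finset.univ.filter p).card).factorial
      else 0 := by
  have h := card_perm_comp_eq (fun t => decide (p t)) (fun t => decide (q t))
  have hc : ∀ r : Fin l → Prop, [DecidablePred r] →
      (Finset.univ.filter fun t => ¬ r t).card = l - (Finset.univ.filter r).card := by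
    intro r _
    have := Finset.card_filter_add_card_filter_not (s := (Finset.univ : Finset (Fin l))) r
    rw [Finset.card_univ, Fintype.card_fin] at this
    omega
  simp only [decide_eq_decide, Bool.forall_bool, decide_eq_false_iff_not, decide_eq_true_eq,
    Fintype.prod_bool, hc] at h
  rw [h]
  refine if_congr ⟨fun h => h.2, fun h => ⟨by rw [h], h⟩⟩ rfl rfl

namespace Protograph

theorem mulVec_parityCheck {h₀ n₀ : ℕ} {E : Type*} [Fintype E] (P : Protograph h₀ n₀ E)
    {l : ℕ} (π : E → Equiv.Perm (Fin l))
    (x : (Fin h₀ ⊕ Fin n₀) × Fin l → ZMod 2) (i : Fin n₀) (t : Fin l) :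
    (P.parityCheck π).mulVec x (i, t) = ∑ g ∈ P.edgesC i, x (P.vn g, π g t) := by
  simp only [Matrix.mulVec, dotProduct, parityCheck, Finset.natCast_card_filter,
    Finset.sum_mul, edgesC, Finset.sum_filter]
  rw [Finset.sum_comm]
  refine Finset.sum_congr rfl fun g _ => ?_
  rw [Finset.sum_eq_single (P.vn g, π g t)]
  · simp
  · rintro ⟨j, s⟩ _ hne
    rw [if_neg, zero_mul]
    rintro ⟨_, h1, h2⟩
    exact hne (by rw [h1, h2])
  · simp

section Enumeration

variable {h₀ n₀ : ℕ} {E : Type*} [Fintype E] [DecidableEq E]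

/-- Number of ones of a word on the copies of a variable node. -/
def columnWeight {V : Type*} {l : ℕ} (x : V × Fin l → ZMod 2) (j : V) : ℕ :=
  (Finset.univ.filter fun t => x (j, t) ≠ 0).card

theorem columnWeight_le {V : Type*} {l : ℕ} (x : V × Fin l → ZMod 2) (j : V) :
    columnWeight x j ≤ l :=
  (Finset.card_filter_le _ _).trans (by simp)

/-- Sequences of configurations in which every edge occurs as often as prescribed by the weights
of the variable nodes. -/
def configWords (P : Protograph h₀ n₀ E) (l : ℕ) (w : Fin h₀ ⊕ Fin n₀ → ℕ) :
    Finset (Fin l → P.Config) :=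
  Finset.univ.filter fun y => ∀ g, (Finset.univ.filter fun t => g ∈ (y t).1).card = w (P.vn g)

/-- Average number of codewords with prescribed weights at the variable nodes. -/
noncomputable def typeEnum (P : Protograph h₀ n₀ E) (l : ℕ) (w : Fin h₀ ⊕ Fin n₀ → ℕ) : ℝ :=
  (∏ j, (l.choose (w j) : ℝ)) * ((P.configWords l w).card / ∏ g, (l.choose (w (P.vn g)) : ℝ))

/-- Weight vectors of words with given input and output weights. -/
def weightTypes (h₀ n₀ l a b : ℕ) : Finset (Fin h₀ ⊕ Fin n₀ → ℕ) :=
  (Fintype.piFinset fun _ => Finset.range (l + 1)).filter fun w =>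
    ∑ j, w (Sum.inl j) = a ∧ ∑ j, w (Sum.inr j) = b

theorem mulVec_parityCheck_eq_zero_iff (P : Protograph h₀ n₀ E) {l : ℕ}
    (π : E → Equiv.Perm (Fin l)) (x : (Fin h₀ ⊕ Fin n₀) × Fin l → ZMod 2) :
    (P.parityCheck π).mulVec x = 0 ↔ ∀ t i,
      Even ((Finset.univ.filter fun g => x (P.vn g, π g t) ≠ 0) ∩ P.edgesC i).card := by
  have hz : ∀ c : ZMod 2, c = if c ≠ 0 then 1 else 0 := by decide
  have h : ∀ i t, (P.parityCheck π).mulVec x (i, t) =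
      (((Finset.univ.filter fun g => x (P.vn g, π g t) ≠ 0) ∩ P.edgesC i).card : ZMod 2) := by
    intro i t
    rw [mulVec_parityCheck, Finset.inter_comm, Finset.inter_filter, Finset.inter_univ,
      Finset.natCast_card_filter]
    exact Finset.sum_congr rfl fun g _ => hz _
  constructor
  · intro h0 t i
    rw [← ZMod.natCast_eq_zero_iff_even, ← h, h0]
    rfl
  · intro h0
    funext ⟨i, t⟩
    rw [h, Pi.zero_apply, ZMod.natCast_eq_zero_iff_even]
    exact h0 t i

/-- Reading the lifted edges copy by copy turns `π` into a word of configurations. For a fixed word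
of configurations the conditions on different edges decouple, and `card_perm_iff` counts each; since
`π` determines its word, the cases are disjoint. -/
theorem card_perms_of_word (P : Protograph h₀ n₀ E) {l : ℕ}
    (x : (Fin h₀ ⊕ Fin n₀) × Fin l → ZMod 2) :
    (Finset.univ.filter fun π : E → Equiv.Perm (Fin l) => (P.parityCheck π).mulVec x = 0).card =
      (P.configWords l (columnWeight x)).card *
        ∏ g, ((columnWeight x (P.vn g)).factorial * (l - columnWeight x (P.vn g)).factorial) := by
  have hfib : ∀ y : Fin l → P.Config,
      (Finset.univ.filter fun π : E → Equiv.Perm (Fin l) =>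
        ∀ t g, x (P.vn g, π g t) ≠ 0 ↔ g ∈ (y t).1).card =
      ∏ g, if (Finset.univ.filter fun t => g ∈ (y t).1).card = columnWeight x (P.vn g)
        then (columnWeight x (P.vn g)).factorial * (l - columnWeight x (P.vn g)).factorial
        else 0 := by
    intro y
    have : (Finset.univ.filter fun π : E → Equiv.Perm (Fin l) =>
        ∀ t g, x (P.vn g, π g t) ≠ 0 ↔ g ∈ (y t).1) =
        Fintype.piFinset fun g => Finset.univ.filter fun σ : Equiv.Perm (Fin l) =>
          ∀ t, x (P.vn g, σ t) ≠ 0 ↔ g ∈ (y t).1 := by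
      ext π
      simp only [Finset.mem_filter, Finset.mem_univ, true_and, Fintype.mem_piFinset]
      exact forall_comm
    rw [this, Fintype.card_piFinset]
    refine Finset.prod_congr rfl fun g _ => ?_
    exact card_perm_iff (fun t => x (P.vn g, t) ≠ 0) fun t => g ∈ (y t).1
  have hunion : (Finset.univ.filter fun π : E → Equiv.Perm (Fin l) =>
      (P.parityCheck π).mulVec x = 0) =
      Finset.univ.biUnion fun y : Fin l → P.Config =>
        Finset.univ.filter fun π : E → Equiv.Perm (Fin l) =>
          ∀ t g, x (P.vn g, π g t) ≠ 0 ↔ g ∈ (y t).1 := by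
    ext π
    simp only [Finset.mem_filter, Finset.mem_univ, true_and, Finset.mem_biUnion,
      mulVec_parityCheck_eq_zero_iff]
    constructor
    · intro h
      exact ⟨fun t => ⟨_, h t⟩, fun t g => by simp⟩
    · rintro ⟨y, hy⟩ t i
      have : (Finset.univ.filter fun g => x (P.vn g, π g t) ≠ 0) = (y t).1 := by
        ext g
        simpa using hy t g
      rw [this]
      exact (y t).2 i
  rw [hunion, Finset.card_biUnion]
  · simp only [hfib]
    rw [configWords, Finset.card_filter, Finset.sum_mul]
    refine Finset.sum_congr rfl fun y _ => ?_
    split_ifs with h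
    · rw [one_mul]
      exact Finset.prod_congr rfl fun g _ => if_pos (h g)
    · obtain ⟨g, hg⟩ := not_forall.1 h
      rw [zero_mul]
      exact Finset.prod_eq_zero (Finset.mem_univ g) (if_neg hg)
  · intro y _ y' _ hne
    refine Finset.disjoint_left.2 fun π hπ hπ' => hne ?_
    simp only [Finset.mem_filter, Finset.mem_univ, true_and] at hπ hπ'
    funext t
    refine Subtype.ext ?_
    ext g
    rw [← hπ t g, hπ' t g]

theorem card_columnWeight_eq {V : Type*} [Fintype V] [DecidableEq V] (l : ℕ) (w : V → ℕ) :
    (Finset.univ.filter fun x : V × Fin l → ZMod 2 => columnWeight x = w).card =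
      ∏ j, l.choose (w j) := by
  have h : ∏ j, l.choose (w j) =
      (Fintype.piFinset fun j => (Finset.univ : Finset (Fin l)).powersetCard (w j)).card := by
    simp [Fintype.card_piFinset]
  rw [h]
  have hz : ∀ c : ZMod 2, (if c ≠ 0 then 1 else 0) = c := by decide
  refine Finset.card_bij' (fun x _ j => Finset.univ.filter fun t => x (j, t) ≠ 0)
    (fun X _ p => if p.2 ∈ X p.1 then 1 else 0) ?_ ?_ ?_ ?_
  · intro x hx
    simp only [Finset.mem_filter, Finset.mem_univ, true_and] at hx
    simp only [Fintype.mem_piFinset, Finset.mem_powersetCard, Finset.subset_univ, true_and]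
    exact fun j => congrFun hx j
  · intro X hX
    simp only [Fintype.mem_piFinset, Finset.mem_powersetCard, Finset.subset_univ, true_and] at hX
    simp only [Finset.mem_filter, Finset.mem_univ, true_and]
    funext j
    rw [← hX j, columnWeight]
    congr 1
    ext t
    simp
  · intro x _
    funext ⟨j, t⟩
    simpa using hz (x (j, t))
  · intro X _
    funext j
    ext t
    simp

theorem hammingNorm_eq_sum_columnWeight {V W : Type*} [Fintype W] {l : ℕ}
    (x : V × Fin l → ZMod 2) (f : W → V) :
    hammingNorm (fun p : W × Fin l => x (f p.1, p.2)) = ∑ j, columnWeight x (f j) := by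
  simp only [hammingNorm, columnWeight, Finset.card_filter]
  rw [Fintype.sum_prod_type]

/-- Exact formula for the average enumerator. -/
theorem avgEnum_eq_sum (P : Protograph h₀ n₀ E) (l a b : ℕ) :
    P.avgEnum l a b = ∑ w ∈ weightTypes h₀ n₀ l a b, P.typeEnum l w := by
  -- Double counting of pairs of permutations and codewords: the inner count depends on `x` only
  -- through its column weights.
  have hcount : ∑ π : E → Equiv.Perm (Fin l), P.ioCount π a b =
      ∑ x ∈ Finset.univ.filter (fun x : (Fin h₀ ⊕ Fin n₀) × Fin l → ZMod 2 =>
        ∑ j, columnWeight x (Sum.inl j) = a ∧ ∑ j, columnWeight x (Sum.inr j) = b),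
        (Finset.univ.filter fun π : E → Equiv.Perm (Fin l) =>
          (P.parityCheck π).mulVec x = 0).card := by
    simp only [ioCount, hammingNorm_eq_sum_columnWeight, Finset.card_filter, Finset.sum_filter]
    rw [Finset.sum_comm]
    refine Finset.sum_congr rfl fun x _ => ?_
    split_ifs with h
    · simp [h]
    · simp [h]
  have hfact : (Fintype.card (E → Equiv.Perm (Fin l)) : ℝ) = ∏ _g : E, (l.factorial : ℝ) := by
    simp [Fintype.card_perm]
  have hchoose : ∀ w ≤ l, ((w.factorial * (l - w).factorial : ℕ) : ℝ) / l.factorial =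
      (l.choose w : ℝ)⁻¹ := by
    intro w hw
    rw [Nat.cast_choose ℝ hw, inv_div, Nat.cast_mul]
  rw [avgEnum, ← Nat.cast_sum, hcount]
  simp only [card_perms_of_word]
  rw [hfact, Nat.cast_sum, Finset.sum_div]
  have hx : ∀ x : (Fin h₀ ⊕ Fin n₀) × Fin l → ZMod 2,
      (((P.configWords l (columnWeight x)).card * ∏ g, ((columnWeight x (P.vn g)).factorial *
        (l - columnWeight x (P.vn g)).factorial) : ℕ) : ℝ) / ∏ _g : E, (l.factorial : ℝ) =
      (P.configWords l (columnWeight x)).card /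
        ∏ g, (l.choose (columnWeight x (P.vn g)) : ℝ) := by
    intro x
    rw [Nat.cast_mul, Nat.cast_prod, mul_div_assoc, ← Finset.prod_div_distrib, div_eq_mul_inv,
      ← Finset.prod_inv_distrib]
    congr 1
    exact Finset.prod_congr rfl fun g _ => hchoose _ (columnWeight_le _ _)
  simp only [hx]
  rw [← Finset.sum_fiberwise_of_maps_to (t := weightTypes h₀ n₀ l a b) (g := columnWeight)]
  · refine Finset.sum_congr rfl fun w hw => ?_
    simp only [weightTypes, Finset.mem_filter] at hw
    have hfil : (Finset.univ.filter fun x : (Fin h₀ ⊕ Fin n₀) × Fin l → ZMod 2 =>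
        ∑ j, columnWeight x (Sum.inl j) = a ∧ ∑ j, columnWeight x (Sum.inr j) = b).filter
          (fun x => columnWeight x = w) = Finset.univ.filter fun x => columnWeight x = w := by
      ext x
      simp only [Finset.mem_filter, Finset.mem_univ, true_and, and_iff_right_iff_imp]
      rintro rfl
      exact hw.2
    rw [hfil, typeEnum, ← Nat.cast_prod, ← card_columnWeight_eq, ← nsmul_eq_mul,
      ← Finset.sum_const]
    refine Finset.sum_congr rfl fun x hx => ?_
    rw [(Finset.mem_filter.1 hx).2]
  · intro x hx
    simp only [Finset.mem_filter, Finset.mem_univ, true_and] at hx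
    simp only [weightTypes, Finset.mem_filter, Fintype.mem_piFinset, Finset.mem_range]
    exact ⟨fun j => Nat.lt_succ_of_le (columnWeight_le x j), hx⟩

end Enumeration

end Protograph

namespace Protograph

/-! ### Exponential bounds for a single weight vector -/

section Bounds

variable {h₀ n₀ : ℕ} {E : Type*} [Fintype E] [DecidableEq E]

theorem typeEnum_nonneg (P : Protograph h₀ n₀ E) (l : ℕ) (w : Fin h₀ ⊕ Fin n₀ → ℕ) :
    0 ≤ P.typeEnum l w := by
  unfold typeEnum
  positivity

theorem avgEnum_nonneg (P : Protograph h₀ n₀ E) (l a b : ℕ) : 0 ≤ P.avgEnum l a b := by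
  rw [avgEnum_eq_sum]
  exact Finset.sum_nonneg fun w _ => P.typeEnum_nonneg l w

theorem mem_weightTypes {l a b : ℕ} {w : Fin h₀ ⊕ Fin n₀ → ℕ} :
    w ∈ weightTypes h₀ n₀ l a b ↔
      (∀ j, w j ≤ l) ∧ ∑ j, w (Sum.inl j) = a ∧ ∑ j, w (Sum.inr j) = b := by
  simp [weightTypes]

theorem typeEnum_le_avgEnum (P : Protograph h₀ n₀ E) {l a b : ℕ} {w : Fin h₀ ⊕ Fin n₀ → ℕ}
    (hw : w ∈ weightTypes h₀ n₀ l a b) : P.typeEnum l w ≤ P.avgEnum l a b := by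
  rw [avgEnum_eq_sum]
  exact Finset.single_le_sum (f := fun w => P.typeEnum l w)
    (fun w _ => P.typeEnum_nonneg l w) hw

theorem typeEnum_pos_iff (P : Protograph h₀ n₀ E) {l : ℕ} {w : Fin h₀ ⊕ Fin n₀ → ℕ}
    (hw : ∀ j, w j ≤ l) : 0 < P.typeEnum l w ↔ (P.configWords l w).Nonempty := by
  have hc : ∀ j, (0 : ℝ) < l.choose (w j) := fun j => by exact_mod_cast Nat.choose_pos (hw j)
  have h1 : 0 < ∏ j, (l.choose (w j) : ℝ) := Finset.prod_pos fun j _ => hc j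
  have h2 : 0 < ∏ g, (l.choose (w (P.vn g)) : ℝ) := Finset.prod_pos fun g _ => hc _
  rw [typeEnum, mul_pos_iff_of_pos_left h1, div_pos_iff_of_pos_right h2, Nat.cast_pos,
    Finset.card_pos]

/-- A sum is at most the number of terms times the largest one, and there are only polynomially many
weight vectors. -/
theorem exists_typeEnum_ge (P : Protograph h₀ n₀ E) {l a b : ℕ} (h : 0 < P.avgEnum l a b) :
    ∃ w ∈ weightTypes h₀ n₀ l a b, 0 < P.typeEnum l w ∧
      P.avgEnum l a b ≤ ((l : ℝ) + 1) ^ (h₀ + n₀) * P.typeEnum l w := by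
  have hne : (weightTypes h₀ n₀ l a b).Nonempty := by
    by_contra hne
    rw [Finset.not_nonempty_iff_eq_empty] at hne
    rw [avgEnum_eq_sum, hne, Finset.sum_empty] at h
    exact h.false
  obtain ⟨w, hw, hmax⟩ := Finset.exists_max_image _ (P.typeEnum l) hne
  have hcard : ((weightTypes h₀ n₀ l a b).card : ℝ) ≤ ((l : ℝ) + 1) ^ (h₀ + n₀) := by
    have := Finset.card_filter_le (Fintype.piFinset fun _ : Fin h₀ ⊕ Fin n₀ =>
      Finset.range (l + 1)) fun w => ∑ j, w (Sum.inl j) = a ∧ ∑ j, w (Sum.inr j) = b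
    simp only [Fintype.card_piFinset, Finset.card_range, Finset.prod_const, Finset.card_univ,
      Fintype.card_sum, Fintype.card_fin] at this
    exact_mod_cast this
  have hle : P.avgEnum l a b ≤ ((l : ℝ) + 1) ^ (h₀ + n₀) * P.typeEnum l w := by
    rw [avgEnum_eq_sum]
    refine (Finset.sum_le_card_nsmul _ _ _ hmax).trans ?_
    rw [nsmul_eq_mul]
    exact mul_le_mul_of_nonneg_right hcard (P.typeEnum_nonneg l w)
  refine ⟨w, hw, ?_, hle⟩
  exact (mul_pos_iff_of_pos_left (by positivity)).1 (h.trans_le hle)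

/-- Enumerators that do not vanish are at least exponentially small. -/
theorem neg_le_log_avgEnum (P : Protograph h₀ n₀ E) {l a b : ℕ} (h : 0 < P.avgEnum l a b) :
    -(l * (Fintype.card E * Real.log 2)) ≤ Real.log (P.avgEnum l a b) := by
  obtain ⟨w, hw, hpos, -⟩ := P.exists_typeEnum_ge h
  have hwl := (mem_weightTypes.1 hw).1
  have h1 : (1 : ℝ) ≤ (P.configWords l w).card := by
    exact_mod_cast Finset.card_pos.2 ((P.typeEnum_pos_iff hwl).1 hpos)
  have h2 : (1 : ℝ) ≤ ∏ j, (l.choose (w j) : ℝ) := by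
    exact_mod_cast Finset.prod_pos fun j _ => Nat.choose_pos (hwl j)
  have h3 : ∏ g, (l.choose (w (P.vn g)) : ℝ) ≤ ((2 : ℝ) ^ l) ^ Fintype.card E := by
    rw [← Finset.card_univ, ← Finset.prod_const]
    refine Finset.prod_le_prod (fun _ _ => by positivity) fun g _ => ?_
    exact_mod_cast Nat.choose_le_two_pow l (w (P.vn g))
  have h4 : 0 < ∏ g, (l.choose (w (P.vn g)) : ℝ) :=
    Finset.prod_pos fun g _ => by exact_mod_cast Nat.choose_pos (hwl _)
  have h5 : (((2 : ℝ) ^ l) ^ Fintype.card E)⁻¹ ≤ P.typeEnum l w := by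
    calc (((2 : ℝ) ^ l) ^ Fintype.card E)⁻¹ ≤ (∏ g, (l.choose (w (P.vn g)) : ℝ))⁻¹ := by gcongr
      _ = 1 * (1 / ∏ g, (l.choose (w (P.vn g)) : ℝ)) := by rw [one_mul, one_div]
      _ ≤ _ := by
        unfold typeEnum
        gcongr
  have h6 := Real.log_le_log (by positivity) (h5.trans (P.typeEnum_le_avgEnum hw))
  rw [Real.log_inv, Real.log_pow, Real.log_pow] at h6
  linarith

/-- Normalized weights of a weight vector. -/
noncomputable def normalized (n₀ : ℕ) {V : Type*} (l : ℕ) (w : V → ℕ) (j : V) : ℝ :=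
  (w j : ℝ) / (n₀ * l)

/-- A variable node contributes its binomial once in the numerator and once per edge in the
denominator, hence the power `1 - degV j`. The absolute value covers isolated nodes, where `degV j -
1` is negative. -/
theorem abs_log_typeEnum_sub_le (hn : 0 < n₀) (P : Protograph h₀ n₀ E) {l : ℕ}
    {w : Fin h₀ ⊕ Fin n₀ → ℕ} (hw : ∀ j, w j ≤ l) (hpos : 0 < P.typeEnum l w) :
    |Real.log (P.typeEnum l w) - (Real.log (P.configWords l w).card -
      n₀ * l * P.entropyV (normalized n₀ l w))| ≤
      (∑ j, |(P.degV j : ℝ) - 1| * 3) * (1 + Real.log (l + 1)) := by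
  have hn' : (n₀ : ℝ) ≠ 0 := by positivity
  have hc : ∀ j, (l.choose (w j) : ℝ) ≠ 0 := fun j => by
    exact_mod_cast (Nat.choose_pos (hw j)).ne'
  have hY : ((P.configWords l w).card : ℝ) ≠ 0 := by
    exact_mod_cast (Finset.card_pos.2 ((P.typeEnum_pos_iff hw).1 hpos)).ne'
  have hedge : ∑ g, Real.log (l.choose (w (P.vn g)) : ℝ) =
      ∑ j, (P.degV j : ℝ) * Real.log (l.choose (w j) : ℝ) := by
    have h := P.sum_edgesV (fun j => Real.log (l.choose (w j) : ℝ)) fun _ => 1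
    simp only [mul_one, Finset.sum_const, nsmul_eq_mul] at h
    rw [← h]
    exact Finset.sum_congr rfl fun j _ => mul_comm _ _
  have hlog : Real.log (P.typeEnum l w) = Real.log (P.configWords l w).card -
      ∑ j, ((P.degV j : ℝ) - 1) * Real.log (l.choose (w j) : ℝ) := by
    rw [typeEnum, Real.log_mul (Finset.prod_ne_zero_iff.2 fun j _ => hc j)
      (div_ne_zero hY (Finset.prod_ne_zero_iff.2 fun g _ => hc _)),
      Real.log_div hY (Finset.prod_ne_zero_iff.2 fun g _ => hc _),
      Real.log_prod fun j _ => hc j, Real.log_prod fun g _ => hc _, hedge]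
    simp only [sub_mul, one_mul, Finset.sum_sub_distrib]
    ring
  have hent : n₀ * l * P.entropyV (normalized n₀ l w) =
      ∑ j, ((P.degV j : ℝ) - 1) * (l * Real.binEntropy ((w j : ℝ) / l)) := by
    rw [entropyV, Finset.mul_sum]
    refine Finset.sum_congr rfl fun j _ => ?_
    have : (n₀ : ℝ) * normalized n₀ l w j = (w j : ℝ) / l := by
      rw [normalized]
      field_simp
    rw [this]
    field_simp
  rw [hlog, hent]
  have : Real.log (P.configWords l w).card -
      ∑ j, ((P.degV j : ℝ) - 1) * Real.log (l.choose (w j) : ℝ) -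
      (Real.log (P.configWords l w).card -
        ∑ j, ((P.degV j : ℝ) - 1) * (l * Real.binEntropy ((w j : ℝ) / l))) =
      -∑ j, ((P.degV j : ℝ) - 1) *
        (Real.log (l.choose (w j) : ℝ) - l * Real.binEntropy ((w j : ℝ) / l)) := by
    simp only [mul_sub, Finset.sum_sub_distrib]
    ring
  rw [this, abs_neg, Finset.sum_mul]
  refine (Finset.abs_sum_le_sum_abs _ _).trans (Finset.sum_le_sum fun j _ => ?_)
  rw [abs_mul, mul_assoc]
  exact mul_le_mul_of_nonneg_left (abs_log_choose_sub_le (hw j)) (abs_nonneg _)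

theorem sum_incidence (P : Protograph h₀ n₀ E) {l : ℕ} (y : Fin l → P.Config) (g : E) :
    ∑ t, P.incidence (y t) g = ((Finset.univ.filter fun t => g ∈ (y t).1).card : ℝ) := by
  simp only [incidence, Finset.natCast_card_filter]

/-- The `l`-th power of the partition function is the generating function of all words. Every word
in `configWords` contributes the same monomial, and the other terms are nonnegative. -/
theorem log_card_configWords_le (P : Protograph h₀ n₀ E) {l : ℕ} {w : Fin h₀ ⊕ Fin n₀ → ℕ}
    (hne : (P.configWords l w).Nonempty) (s : E → ℝ) :
    Real.log (P.configWords l w).card ≤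
      l * logPartition P.incidence s - ∑ g, (w (P.vn g) : ℝ) * s g := by
  have hterm : ∀ y ∈ P.configWords l w, ∏ t, Real.exp (∑ g, P.incidence (y t) g * s g) =
      Real.exp (∑ g, (w (P.vn g) : ℝ) * s g) := by
    intro y hy
    rw [← Real.exp_sum, Finset.sum_comm]
    simp only [← Finset.sum_mul, sum_incidence, (Finset.mem_filter.1 hy).2]
  have h1 : (P.configWords l w).card * Real.exp (∑ g, (w (P.vn g) : ℝ) * s g) ≤
      (∑ u, Real.exp (∑ g, P.incidence u g * s g)) ^ l := by
    rw [← nsmul_eq_mul, ← Finset.sum_const, ← Finset.sum_congr rfl hterm, Fintype.sum_pow]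
    exact Finset.sum_le_sum_of_subset_of_nonneg (Finset.subset_univ _)
      fun y _ _ => Finset.prod_nonneg fun t _ => (Real.exp_pos _).le
  have hY : (0 : ℝ) < (P.configWords l w).card := by exact_mod_cast Finset.card_pos.2 hne
  have h2 := Real.log_le_log (by positivity) h1
  rw [Real.log_mul hY.ne' (Real.exp_pos _).ne', Real.log_exp, Real.log_pow] at h2
  rw [logPartition]
  linarith

/-- All words with letter counts `k` lie in `configWords`, and a multinomial coefficient counts
them. -/
theorem log_card_configWords_ge (P : Protograph h₀ n₀ E) {l : ℕ} {w : Fin h₀ ⊕ Fin n₀ → ℕ}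
    (k : P.Config → ℕ) (hk : ∑ u, k u = l)
    (hkw : ∀ g, ∑ u, (if g ∈ u.1 then k u else 0) = w (P.vn g)) :
    (P.configWords l w).Nonempty ∧
    l * ∑ u, Real.negMulLog ((k u : ℝ) / l) -
      ((Fintype.card P.Config : ℝ) + 1) * (1 + Real.log (l + 1)) ≤
        Real.log (P.configWords l w).card := by
  have hsub : (Finset.univ.filter fun y : Fin l → P.Config =>
      ∀ u, (Finset.univ.filter fun t => y t = u).card = k u) ⊆ P.configWords l w := by
    intro y hy
    simp only [Finset.mem_filter, Finset.mem_univ, true_and] at hy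
    simp only [configWords, Finset.mem_filter, Finset.mem_univ, true_and]
    intro g
    rw [← hkw g, Finset.card_eq_sum_card_fiberwise (f := y) (t := Finset.univ)
      fun _ _ => Finset.mem_coe.2 (Finset.mem_univ _)]
    refine Finset.sum_congr rfl fun u _ => ?_
    rw [← hy u, Finset.filter_filter]
    split_ifs with hg
    · congr 1
      ext t
      simp only [Finset.mem_filter, Finset.mem_univ, true_and, and_iff_right_iff_imp]
      rintro rfl
      exact hg
    · rw [Finset.card_eq_zero, Finset.filter_eq_empty_iff]
      rintro t - ⟨h1, rfl⟩
      exact hg h1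
  have h1 := (factorial_le_card_mul_prod_factorial k hk).trans
    (Nat.mul_le_mul_right _ (Finset.card_le_card hsub))
  have hne : 0 < (P.configWords l w).card := by
    by_contra h0
    rw [Nat.le_zero.1 (not_lt.1 h0), zero_mul] at h1
    exact absurd h1 (not_le.2 l.factorial_pos)
  refine ⟨Finset.card_pos.1 hne, ?_⟩
  have hY : (0 : ℝ) < (P.configWords l w).card := by exact_mod_cast hne
  have h2 : (l.factorial : ℝ) ≤ (P.configWords l w).card * ∏ u, ((k u).factorial : ℝ) := by
    exact_mod_cast h1
  have h3 := Real.log_le_log (by positivity) h2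
  rw [Real.log_mul hY.ne' (by positivity), Real.log_prod fun u _ => by positivity] at h3
  have h4 := (abs_le.1 (abs_log_factorial_sub_sum_sub_le k hk)).1
  linarith

theorem log_typeEnum_le (hn : 0 < n₀) (P : Protograph h₀ n₀ E) {l : ℕ} (hl : 0 < l)
    {w : Fin h₀ ⊕ Fin n₀ → ℕ} (hw : ∀ j, w j ≤ l) (hpos : 0 < P.typeEnum l w)
    {z : E → ℝ} (hz : ∀ g, 0 < z g) :
    Real.log (P.typeEnum l w) ≤ n₀ * l * P.Gexpr z (normalized n₀ l w) +
      (∑ j, |(P.degV j : ℝ) - 1| * 3) * (1 + Real.log (l + 1)) := by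
  have hn' : (n₀ : ℝ) ≠ 0 := by positivity
  have hl' : (l : ℝ) ≠ 0 := by positivity
  have h1 := (abs_le.1 (P.abs_log_typeEnum_sub_le hn hw hpos)).2
  have h2 := P.log_card_configWords_le ((P.typeEnum_pos_iff hw).1 hpos) fun g => Real.log (z g)
  have h3 : n₀ * l * P.Gexpr z (normalized n₀ l w) =
      l * logPartition P.incidence (fun g => Real.log (z g)) -
        ∑ g, (w (P.vn g) : ℝ) * Real.log (z g) - n₀ * l * P.entropyV (normalized n₀ l w) := by
    have h4 : ∑ g, (w (P.vn g) : ℝ) * Real.log (z g) =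
        l * ∑ g, n₀ * normalized n₀ l w (P.vn g) * Real.log (z g) := by
      rw [Finset.mul_sum]
      refine Finset.sum_congr rfl fun g _ => ?_
      rw [normalized]
      field_simp
    rw [P.Gexpr_eq hn hz, h4]
    field_simp
  linarith

theorem log_typeEnum_ge (hn : 0 < n₀) (P : Protograph h₀ n₀ E) {l : ℕ}
    {w : Fin h₀ ⊕ Fin n₀ → ℕ} (hw : ∀ j, w j ≤ l) (k : P.Config → ℕ) (hk : ∑ u, k u = l)
    (hkw : ∀ g, ∑ u, (if g ∈ u.1 then k u else 0) = w (P.vn g)) :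
    0 < P.typeEnum l w ∧
    l * ∑ u, Real.negMulLog ((k u : ℝ) / l) - n₀ * l * P.entropyV (normalized n₀ l w) -
      (∑ j, |(P.degV j : ℝ) - 1| * 3 + (Fintype.card P.Config + 1)) * (1 + Real.log (l + 1)) ≤
        Real.log (P.typeEnum l w) := by
  obtain ⟨hne, h1⟩ := P.log_card_configWords_ge k hk hkw
  have hpos := (P.typeEnum_pos_iff hw).2 hne
  have h2 := (abs_le.1 (P.abs_log_typeEnum_sub_le hn hw hpos)).1
  refine ⟨hpos, ?_⟩
  rw [add_mul]
  linarith

/-- A word of configurations yields integer counts. -/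
theorem exists_counts_of_configWords (P : Protograph h₀ n₀ E) {l : ℕ} {w : Fin h₀ ⊕ Fin n₀ → ℕ}
    (hne : (P.configWords l w).Nonempty) :
    ∃ k : P.Config → ℕ, ∑ u, k u = l ∧
      ∀ g, ∑ u, (if g ∈ u.1 then k u else 0) = w (P.vn g) := by
  obtain ⟨y, hy⟩ := hne
  simp only [configWords, Finset.mem_filter, Finset.mem_univ, true_and] at hy
  refine ⟨fun u => (Finset.univ.filter fun t => y t = u).card, ?_, fun g => ?_⟩
  · rw [← Finset.card_eq_sum_card_fiberwise fun _ _ => Finset.mem_coe.2 (Finset.mem_univ _)]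
    simp
  · rw [← hy g, Finset.card_eq_sum_card_fiberwise (f := y) (t := Finset.univ)
      fun _ _ => Finset.mem_coe.2 (Finset.mem_univ _)]
    refine Finset.sum_congr rfl fun u _ => ?_
    rw [Finset.filter_filter]
    split_ifs with hg
    · refine congrArg Finset.card ?_
      ext t
      simp only [Finset.mem_filter, Finset.mem_univ, true_and, iff_and_self]
      rintro rfl
      exact hg
    · symm
      rw [Finset.card_eq_zero, Finset.filter_eq_empty_iff]
      rintro t - ⟨h1, rfl⟩
      exact hg h1

end Bounds

end Protograph

/-! ### Growth rates along convergent weights -/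

theorem tendsto_one_add_log_div :
    Tendsto (fun l : ℕ => (1 + Real.log ((l : ℝ) + 1)) / l) atTop (𝓝 0) := by
  have h1 : Tendsto (fun x : ℝ => Real.log x / x) atTop (𝓝 0) := by
    simpa using Real.isLittleO_log_id_atTop.tendsto_div_nhds_zero
  have h2 : Tendsto (fun l : ℕ => (l : ℝ) + 1) atTop atTop :=
    tendsto_atTop_add_const_right _ _ tendsto_natCast_atTop_atTop
  have h3 : Tendsto (fun l : ℕ => (1 : ℝ) / l) atTop (𝓝 0) := tendsto_one_div_atTop_nhds_zero_nat
  have h4 : Tendsto (fun l : ℕ => 1 / (l : ℝ) + Real.log ((l : ℝ) + 1) / (l + 1) * (1 + 1 / l))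
      atTop (𝓝 (0 + 0 * (1 + 0))) := h3.add ((h1.comp h2).mul (h3.const_add 1))
  simp only [zero_mul, add_zero] at h4
  refine h4.congr' ?_
  filter_upwards [eventually_gt_atTop 0] with l hl
  have : (0 : ℝ) < l := by exact_mod_cast hl
  field_simp

namespace Protograph

section Filters

variable {h₀ n₀ : ℕ} {E : Type*} [Fintype E] [DecidableEq E]

instance (n₀ : ℕ) (α β : ℝ) : (weightFilter n₀ α β).IsCountablyGenerated := by
  unfold weightFilter
  infer_instance

instance (P : Protograph h₀ n₀ E) (α β : ℝ) : (P.ioFilter α β).IsCountablyGenerated := by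
  unfold ioFilter
  infer_instance

theorem tendsto_weightFilter_iff {ι : Type*} {F : Filter ι} {α β : ℝ} {t : ι → ℕ × ℕ × ℕ} :
    Tendsto t F (weightFilter n₀ α β) ↔ Tendsto (fun i => (t i).1) F atTop ∧
      Tendsto (fun i => ((t i).2.1 : ℝ) / ((n₀ : ℝ) * (t i).1)) F (𝓝 α) ∧
      Tendsto (fun i => ((t i).2.2 : ℝ) / ((n₀ : ℝ) * (t i).1)) F (𝓝 β) := by
  simp only [weightFilter, tendsto_inf, tendsto_comap_iff, and_assoc, Function.comp_def]

theorem tendsto_ioFilter_iff (P : Protograph h₀ n₀ E) {ι : Type*} {F : Filter ι} {α β : ℝ}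
    {t : ι → ℕ × ℕ × ℕ} :
    Tendsto t F (P.ioFilter α β) ↔ Tendsto t F (weightFilter n₀ α β) ∧
      ∀ᶠ i in F, 0 < P.avgEnum (t i).1 (t i).2.1 (t i).2.2 := by
  simp only [ioFilter, tendsto_inf, tendsto_principal, Set.mem_ofPred_eq]

theorem eventually_ioFilter_pos (P : Protograph h₀ n₀ E) (α β : ℝ) :
    ∀ᶠ t in P.ioFilter α β, 0 < t.1 ∧ 0 < P.avgEnum t.1 t.2.1 t.2.2 := by
  obtain ⟨h1, h2⟩ := (P.tendsto_ioFilter_iff (α := α) (β := β)).1 tendsto_id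
  exact ((tendsto_weightFilter_iff.1 h1).1.eventually_gt_atTop 0).and h2

/-- Upper bound: the growth rate does not exceed the largest exponent. -/
theorem eventually_rate_lt (hn : 0 < n₀) (P : Protograph h₀ n₀ E) {α β x : ℝ}
    (hx : ∀ δ ∈ weights h₀ n₀ α β, P.J δ < (x : EReal)) :
    ∀ᶠ t in P.ioFilter α β, 1 / ((n₀ : ℝ) * t.1) * Real.log (P.avgEnum t.1 t.2.1 t.2.2) < x := by
  have hn' : (0 : ℝ) < n₀ := by exact_mod_cast hn
  by_contra hcon
  obtain ⟨t, ht, htp⟩ := exists_seq_forall_of_frequently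
    ((not_eventually.1 hcon).and_eventually (P.eventually_ioFilter_pos α β))
  obtain ⟨hl, ha, hb⟩ := tendsto_weightFilter_iff.1 (P.tendsto_ioFilter_iff.1 ht).1
  choose w hw hwpos hwle using fun n => P.exists_typeEnum_ge (htp n).2.2
  have hlpos : ∀ n, (0 : ℝ) < (t n).1 := fun n => by exact_mod_cast (htp n).2.1
  have hmem : ∀ n, normalized n₀ (t n).1 (w n) ∈
      Set.pi Set.univ fun _ : Fin h₀ ⊕ Fin n₀ => Set.Icc (0 : ℝ) (1 / n₀) := by
    intro n j _
    have h1 := hlpos n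
    have h2 : (w n j : ℝ) ≤ (t n).1 := by exact_mod_cast (mem_weightTypes.1 (hw n)).1 j
    refine ⟨by unfold normalized; positivity, ?_⟩
    rw [normalized, div_le_div_iff₀ (by positivity) hn']
    nlinarith
  -- The dominant weight vectors of a bad sequence accumulate at some admissible `δ`.
  obtain ⟨δ, hδ, φ, hφ, hlim⟩ := (isCompact_univ_pi fun _ : Fin h₀ ⊕ Fin n₀ =>
    isCompact_Icc (a := (0 : ℝ)) (b := 1 / (n₀ : ℝ))).tendsto_subseq hmem
  have hφt := hφ.tendsto_atTop
  have hj : ∀ j, Tendsto (fun n => normalized n₀ (t (φ n)).1 (w (φ n)) j) atTop (𝓝 (δ j)) :=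
    fun j => tendsto_pi_nhds.1 hlim j
  have hδw : δ ∈ weights h₀ n₀ α β := by
    refine ⟨fun j => hδ j trivial, ?_, ?_⟩
    · refine tendsto_nhds_unique (tendsto_finsetSum _ fun j _ => hj (Sum.inl j))
        ((ha.comp hφt).congr fun n => ?_)
      simp only [Function.comp, normalized, ← (mem_weightTypes.1 (hw (φ n))).2.1, Nat.cast_sum,
        Finset.sum_div]
    · refine tendsto_nhds_unique (tendsto_finsetSum _ fun j _ => hj (Sum.inr j))
        ((hb.comp hφt).congr fun n => ?_)
      simp only [Function.comp, normalized, ← (mem_weightTypes.1 (hw (φ n))).2.2, Nat.cast_sum,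
        Finset.sum_div]
  -- Since the infimum at the limit is below `x`, one fixed `z` already has value below `x`; its
  -- bound is continuous in the weights and contradicts badness.
  have hJ := hx δ hδw
  simp only [J, iInf_lt_iff] at hJ
  obtain ⟨z, hz, hzx⟩ := hJ
  rw [EReal.coe_lt_coe_iff] at hzx
  set D : ℝ := ∑ j, |(P.degV j : ℝ) - 1| * 3 + (h₀ + n₀ : ℕ) with hD
  have hbound : ∀ n, x ≤ P.Gexpr z (normalized n₀ (t n).1 (w n)) +
      D / n₀ * ((1 + Real.log (((t n).1 : ℝ) + 1)) / (t n).1) := by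
    intro n
    have h1 := hlpos n
    refine (not_lt.1 (htp n).1).trans ?_
    have h2 := Real.log_le_log (htp n).2.2 (hwle n)
    rw [Real.log_mul (by positivity) (hwpos n).ne', Real.log_pow] at h2
    have h3 := P.log_typeEnum_le hn (htp n).2.1 (mem_weightTypes.1 (hw n)).1 (hwpos n) hz
    have h4 : Real.log (P.avgEnum (t n).1 (t n).2.1 (t n).2.2) ≤
        n₀ * (t n).1 * P.Gexpr z (normalized n₀ (t n).1 (w n)) +
          D * (1 + Real.log (((t n).1 : ℝ) + 1)) := by
      rw [hD, add_mul]
      have : (0 : ℝ) ≤ (h₀ + n₀ : ℕ) := Nat.cast_nonneg _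
      linarith
    rw [one_div_mul_eq_div, div_le_iff₀ (by positivity)]
    refine h4.trans_eq ?_
    field_simp
  have hlim2 : Tendsto (fun n => P.Gexpr z (normalized n₀ (t (φ n)).1 (w (φ n))) +
      D / n₀ * ((1 + Real.log (((t (φ n)).1 : ℝ) + 1)) / (t (φ n)).1)) atTop
      (𝓝 (P.Gexpr z δ + D / n₀ * 0)) :=
    (((P.continuous_Gexpr z).tendsto δ).comp hlim).add
      ((tendsto_one_add_log_div.comp (hl.comp hφt)).const_mul _)
  have := ge_of_tendsto' hlim2 fun n => hbound (φ n)
  linarith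

/-- Integer equations for the configuration counts, the weights `w` of the variable nodes and
their complements `l - w`: normalization, complementarity, consistency at the edges. -/
def consistencyRow (P : Protograph h₀ n₀ E) : Unit ⊕ (Fin h₀ ⊕ Fin n₀) ⊕ E →
    P.Config ⊕ (Fin h₀ ⊕ Fin n₀) ⊕ (Fin h₀ ⊕ Fin n₀) → ℤ
  | Sum.inl _ => Sum.elim 1 0
  | Sum.inr (Sum.inl j) => Sum.elim 0 (Sum.elim (Pi.single j 1) (Pi.single j 1))
  | Sum.inr (Sum.inr g) => Sum.elim (fun u => if g ∈ u.1 then 1 else 0)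
      (Sum.elim (-Pi.single (P.vn g) 1) 0)

/-- Integer equations for the total input and output weights. -/
def totalWeightRow (P : Protograph h₀ n₀ E) (c : Bool) :
    P.Config ⊕ (Fin h₀ ⊕ Fin n₀) ⊕ (Fin h₀ ⊕ Fin n₀) → ℤ :=
  Sum.elim 0 (Sum.elim (fun j => if j.isLeft = c then 1 else 0) 0)

section Rows

variable (P : Protograph h₀ n₀ E) {R : Type*} [CommRing R]
  (x : P.Config ⊕ (Fin h₀ ⊕ Fin n₀) ⊕ (Fin h₀ ⊕ Fin n₀) → R)

theorem sum_consistencyRow_total (i : Unit) :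
    ∑ v, (P.consistencyRow (Sum.inl i) v : R) * x v = ∑ u, x (Sum.inl u) := by
  rw [Fintype.sum_sum_type]
  simp [consistencyRow]

theorem sum_consistencyRow_weight (j : Fin h₀ ⊕ Fin n₀) :
    ∑ v, (P.consistencyRow (Sum.inr (Sum.inl j)) v : R) * x v =
      x (Sum.inr (Sum.inl j)) + x (Sum.inr (Sum.inr j)) := by
  have h : ∀ k : Fin h₀ ⊕ Fin n₀, ((Pi.single j (1 : ℤ) : _ → ℤ) k : R) =
      if k = j then 1 else 0 := by
    intro k
    by_cases hk : k = j <;> simp [hk]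
  rw [Fintype.sum_sum_type, Fintype.sum_sum_type]
  simp only [consistencyRow, Sum.elim_inl, Sum.elim_inr, h, Pi.zero_apply, Int.cast_zero,
    zero_mul, Finset.sum_const_zero, ite_mul, one_mul, Finset.sum_ite_eq', Finset.mem_univ,
    if_true, zero_add]

theorem sum_consistencyRow_edge (g : E) :
    ∑ v, (P.consistencyRow (Sum.inr (Sum.inr g)) v : R) * x v =
      ∑ u : P.Config, (if g ∈ u.1 then x (Sum.inl u) else 0) -
        x (Sum.inr (Sum.inl (P.vn g))) := by
  have h : ∀ k : Fin h₀ ⊕ Fin n₀, ((Pi.single (P.vn g) (1 : ℤ) : _ → ℤ) k : R) =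
      if k = P.vn g then 1 else 0 := by
    intro k
    by_cases hk : k = P.vn g <;> simp [hk]
  rw [Fintype.sum_sum_type, Fintype.sum_sum_type]
  simp only [consistencyRow, Sum.elim_inl, Sum.elim_inr, Pi.neg_apply, Int.cast_neg, h,
    Pi.zero_apply, Int.cast_zero, zero_mul, Finset.sum_const_zero, Int.cast_ite, Int.cast_one,
    neg_mul, Finset.sum_neg_distrib, ite_mul, one_mul, Finset.sum_ite_eq', Finset.mem_univ,
    if_true, add_zero, sub_eq_add_neg]

theorem sum_totalWeightRow_true :
    ∑ v, (P.totalWeightRow true v : R) * x v = ∑ j, x (Sum.inr (Sum.inl (Sum.inl j))) := by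
  rw [Fintype.sum_sum_type, Fintype.sum_sum_type, Fintype.sum_sum_type]
  simp [totalWeightRow]

theorem sum_totalWeightRow_false :
    ∑ v, (P.totalWeightRow false v : R) * x v = ∑ j, x (Sum.inr (Sum.inl (Sum.inr j))) := by
  rw [Fintype.sum_sum_type, Fintype.sum_sum_type, Fintype.sum_sum_type]
  simp [totalWeightRow]

end Rows

/-- Distribution on configurations and normalized weights, with the complements. -/
noncomputable def limitPoint (P : Protograph h₀ n₀ E) (κ : P.Config → ℝ)
    (δ : Fin h₀ ⊕ Fin n₀ → ℝ) : P.Config ⊕ (Fin h₀ ⊕ Fin n₀) ⊕ (Fin h₀ ⊕ Fin n₀) → ℝ :=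
  Sum.elim κ (Sum.elim (fun j => n₀ * δ j) fun j => 1 - n₀ * δ j)

theorem limitPoint_nonneg (hn : 0 < n₀) (P : Protograph h₀ n₀ E) {α β : ℝ} {κ : P.Config → ℝ}
    {δ : Fin h₀ ⊕ Fin n₀ → ℝ} (hδ : δ ∈ weights h₀ n₀ α β) (h0 : ∀ u, 0 ≤ κ u) (v) :
    0 ≤ P.limitPoint κ δ v := by
  have hn' : (0 : ℝ) < n₀ := by exact_mod_cast hn
  rcases v with u | j | j
  · exact h0 u
  · exact mul_nonneg hn'.le (hδ.1 j).1
  · have := (hδ.1 j).2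
    rw [le_div_iff₀ hn'] at this
    simp only [limitPoint, Sum.elim_inr]
    linarith

theorem sum_consistencyRow_limitPoint (P : Protograph h₀ n₀ E) {κ : P.Config → ℝ}
    {δ : Fin h₀ ⊕ Fin n₀ → ℝ} (h1 : ∑ u, κ u = 1)
    (hκ : ∀ g, ∑ u, κ u * P.incidence u g = n₀ * δ (P.vn g)) (i) :
    ∑ v, (P.consistencyRow i v : ℝ) * P.limitPoint κ δ v =
      ((Sum.elim (fun _ => 1) (Sum.elim (fun _ => 1) fun _ => 0) i : ℤ) : ℝ) := by
  rcases i with i | j | g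
  · rw [sum_consistencyRow_total]
    simpa [limitPoint] using h1
  · rw [sum_consistencyRow_weight]
    simp [limitPoint]
  · rw [sum_consistencyRow_edge]
    have := hκ g
    simp only [incidence, mul_ite, mul_one, mul_zero] at this
    simp [limitPoint, this]

/-- Lower bound: any distribution on configurations with consistent marginals bounds the growth
rate from below. -/
theorem eventually_lt_rate (hn : 0 < n₀) (P : Protograph h₀ n₀ E) {α β x : ℝ}
    {δ : Fin h₀ ⊕ Fin n₀ → ℝ} (hδ : δ ∈ weights h₀ n₀ α β) {κ : P.Config → ℝ}
    (h0 : ∀ u, 0 ≤ κ u) (h1 : ∑ u, κ u = 1)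
    (hκ : ∀ g, ∑ u, κ u * P.incidence u g = n₀ * δ (P.vn g))
    (hx : x < 1 / (n₀ : ℝ) * ∑ u, Real.negMulLog (κ u) - P.entropyV δ) :
    ∀ᶠ t in P.ioFilter α β, x < 1 / ((n₀ : ℝ) * t.1) * Real.log (P.avgEnum t.1 t.2.1 t.2.2) := by
  have hn' : (0 : ℝ) < n₀ := by exact_mod_cast hn
  by_contra hcon
  obtain ⟨t, ht, htp⟩ := exists_seq_forall_of_frequently
    ((not_eventually.1 hcon).and_eventually (P.eventually_ioFilter_pos α β))
  obtain ⟨hl, ha, hb⟩ := tendsto_weightFilter_iff.1 (P.tendsto_ioFilter_iff.1 ht).1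
  have hlpos : ∀ n, (0 : ℝ) < (t n).1 := fun n => by exact_mod_cast (htp n).2.1
  -- Positivity of the enumerator supplies a genuine integer solution with the exact `(l, a, b)`;
  -- this settles every arithmetic obstruction that `κ` cannot see.
  choose w hw hwpos _ using fun n => P.exists_typeEnum_ge (htp n).2.2
  choose k hk hkw using fun n => P.exists_counts_of_configWords
    ((P.typeEnum_pos_iff (mem_weightTypes.1 (hw n)).1).1 (hwpos n))
  -- The complements `l - w` act as slack variables, so that `w ≤ l` becomes nonnegativity.
  set y : ℕ → P.Config ⊕ (Fin h₀ ⊕ Fin n₀) ⊕ (Fin h₀ ⊕ Fin n₀) → ℕ := fun n =>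
    Sum.elim (k n) (Sum.elim (w n) fun j => (t n).1 - w n j) with hy
  have hrows : ∀ n (y' : P.Config ⊕ (Fin h₀ ⊕ Fin n₀) ⊕ (Fin h₀ ⊕ Fin n₀) → ℕ),
      (∀ i, ∑ v, Sum.elim P.consistencyRow P.totalWeightRow i v * (y' v : ℤ) =
        ∑ v, Sum.elim P.consistencyRow P.totalWeightRow i v * (y n v : ℤ)) ↔
      ∑ u, y' (Sum.inl u) = (t n).1 ∧
      (∀ j, y' (Sum.inr (Sum.inl j)) + y' (Sum.inr (Sum.inr j)) = (t n).1) ∧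
      (∀ g, ∑ u : P.Config, (if g ∈ u.1 then y' (Sum.inl u) else 0) =
        y' (Sum.inr (Sum.inl (P.vn g)))) ∧
      ∑ j, y' (Sum.inr (Sum.inl (Sum.inl j))) = (t n).2.1 ∧
      ∑ j, y' (Sum.inr (Sum.inl (Sum.inr j))) = (t n).2.2 := by
    intro n y'
    obtain ⟨hw1, hw2, hw3⟩ := mem_weightTypes.1 (hw n)
    have e1 := fun i => P.sum_consistencyRow_total (R := ℤ) (fun v => (y' v : ℤ)) i
    have e2 := fun i => P.sum_consistencyRow_weight (R := ℤ) (fun v => (y' v : ℤ)) i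
    have e3 := fun i => P.sum_consistencyRow_edge (R := ℤ) (fun v => (y' v : ℤ)) i
    have e4 := P.sum_totalWeightRow_true (R := ℤ) (fun v => (y' v : ℤ))
    have e5 := P.sum_totalWeightRow_false (R := ℤ) (fun v => (y' v : ℤ))
    have f1 := fun i => P.sum_consistencyRow_total (R := ℤ) (fun v => (y n v : ℤ)) i
    have f2 := fun i => P.sum_consistencyRow_weight (R := ℤ) (fun v => (y n v : ℤ)) i
    have f3 := fun i => P.sum_consistencyRow_edge (R := ℤ) (fun v => (y n v : ℤ)) i
    have f4 := P.sum_totalWeightRow_true (R := ℤ) (fun v => (y n v : ℤ))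
    have f5 := P.sum_totalWeightRow_false (R := ℤ) (fun v => (y n v : ℤ))
    simp only [Int.cast_id] at e1 e2 e3 e4 e5 f1 f2 f3 f4 f5
    have g1 : ∑ u, y n (Sum.inl u) = (t n).1 := by simpa [hy] using hk n
    have g2 : ∀ j, y n (Sum.inr (Sum.inl j)) + y n (Sum.inr (Sum.inr j)) = (t n).1 := by
      intro j
      have := hw1 j
      simp only [hy, Sum.elim_inl, Sum.elim_inr]
      omega
    have g3 : ∀ g, ∑ u : P.Config, (if g ∈ u.1 then y n (Sum.inl u) else 0) =
        y n (Sum.inr (Sum.inl (P.vn g))) := fun g => hkw n g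
    have g4 : ∑ j, y n (Sum.inr (Sum.inl (Sum.inl j))) = (t n).2.1 := hw2
    have g5 : ∑ j, y n (Sum.inr (Sum.inl (Sum.inr j))) = (t n).2.2 := hw3
    zify at g1 g2 g3 g4 g5 ⊢
    rw [Sum.forall, Sum.forall, Sum.forall, Bool.forall_bool]
    simp only [Sum.elim_inl, Sum.elim_inr, e1, e2, e3, e4, e5, f1, f2, f3, f4, f5, g1, g2, g3, g4,
      g5, sub_self, sub_eq_zero]
    simp only [forall_const]
    tauto
  obtain ⟨y', hy', hlim⟩ := exists_nat_solutions_tendsto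
    (Sum.elim P.consistencyRow P.totalWeightRow) (P.limitPoint κ δ)
    (P.limitPoint_nonneg hn hδ h0) (fun n => (t n).1) hl y (by
      intro n y'' hy'' v
      obtain ⟨r1, r2, -⟩ := (hrows n y'').1 hy''
      rcases v with u | j | j
      · rw [← r1]
        exact Finset.single_le_sum (f := fun u => y'' (Sum.inl u)) (fun _ _ => Nat.zero_le _)
          (Finset.mem_univ u)
      · have := r2 j
        omega
      · have := r2 j
        omega) (by
      obtain hself := fun n => (hrows n (y n)).1 fun i => rfl
      rintro (i | c)
      · simp only [Sum.elim_inl]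
        rw [P.sum_consistencyRow_limitPoint h1 hκ]
        refine Tendsto.congr (fun n => ?_) tendsto_const_nhds
        have hne := (hlpos n).ne'
        obtain ⟨r1, r2, r3, -⟩ := hself n
        rcases i with i | j | g
        · rw [sum_consistencyRow_total, ← Nat.cast_sum, r1]
          simp [hne]
        · rw [sum_consistencyRow_weight, ← Nat.cast_add, r2]
          simp [hne]
        · rw [sum_consistencyRow_edge, ← r3]
          simp
      · simp only [Sum.elim_inr]
        rcases c with _ | _
        · rw [sum_totalWeightRow_false]
          have : ∑ j : Fin n₀, P.limitPoint κ δ (Sum.inr (Sum.inl (Sum.inr j))) = n₀ * β := by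
            simp only [limitPoint, Sum.elim_inr, Sum.elim_inl, ← Finset.mul_sum, hδ.2.2]
          rw [this]
          refine (hb.const_mul (n₀ : ℝ)).congr fun n => ?_
          rw [sum_totalWeightRow_false, ← Nat.cast_sum, (hself n).2.2.2.2]
          have hne := (hlpos n).ne'
          field_simp
        · rw [sum_totalWeightRow_true]
          have : ∑ j : Fin h₀, P.limitPoint κ δ (Sum.inr (Sum.inl (Sum.inl j))) = n₀ * α := by
            simp only [limitPoint, Sum.elim_inr, Sum.elim_inl, ← Finset.mul_sum, hδ.2.1]
          rw [this]
          refine (ha.const_mul (n₀ : ℝ)).congr fun n => ?_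
          rw [sum_totalWeightRow_true, ← Nat.cast_sum, (hself n).2.2.2.1]
          have hne := (hlpos n).ne'
          field_simp)
  set D : ℝ := ∑ j, |(P.degV j : ℝ) - 1| * 3 + (Fintype.card P.Config + 1) with hD
  have hbound : ∀ n, 1 / (n₀ : ℝ) * ∑ u, Real.negMulLog ((y' n (Sum.inl u) : ℝ) / (t n).1) -
      P.entropyV (normalized n₀ (t n).1 fun j => y' n (Sum.inr (Sum.inl j))) -
      D / n₀ * ((1 + Real.log (((t n).1 : ℝ) + 1)) / (t n).1) ≤ x := by
    intro n
    obtain ⟨r1, r2, r3, r4, r5⟩ := (hrows n (y' n)).1 (hy' n)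
    have hpos := hlpos n
    have hle : ∀ j, y' n (Sum.inr (Sum.inl j)) ≤ (t n).1 := fun j => by
      have := r2 j
      omega
    obtain ⟨b1, b2⟩ := P.log_typeEnum_ge hn hle _ r1 r3
    have b3 := b2.trans (Real.log_le_log b1
      (P.typeEnum_le_avgEnum (mem_weightTypes.2 ⟨hle, r4, r5⟩)))
    refine le_trans ?_ (not_lt.1 (htp n).1)
    rw [one_div_mul_eq_div ((n₀ : ℝ) * _), le_div_iff₀ (by positivity)]
    rw [← hD] at b3
    refine le_trans (le_of_eq ?_) b3
    field_simp
  have hlimH : Tendsto (fun n => ∑ u, Real.negMulLog ((y' n (Sum.inl u) : ℝ) / (t n).1)) atTop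
      (𝓝 (∑ u, Real.negMulLog (κ u))) :=
    tendsto_finsetSum _ fun u _ => (Real.continuous_negMulLog.tendsto _).comp (hlim (Sum.inl u))
  have hlimw : Tendsto (fun n => normalized n₀ (t n).1 fun j => y' n (Sum.inr (Sum.inl j))) atTop
      (𝓝 δ) := by
    refine tendsto_pi_nhds.2 fun j => ?_
    have := (hlim (Sum.inr (Sum.inl j))).div_const (n₀ : ℝ)
    have e : P.limitPoint κ δ (Sum.inr (Sum.inl j)) / n₀ = δ j := by
      simp only [limitPoint, Sum.elim_inr, Sum.elim_inl]
      field_simp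
    rw [e] at this
    refine this.congr fun n => ?_
    rw [normalized, div_div, mul_comm]
  have hfin := le_of_tendsto' (((hlimH.const_mul (1 / (n₀ : ℝ))).sub
    ((P.continuous_entropyV.tendsto δ).comp hlimw)).sub
      ((tendsto_one_add_log_div.comp hl).const_mul (D / n₀))) hbound
  linarith

/-- Real consistent marginals are limits of the weights of actual codewords. -/
theorem ioFilter_neBot (hn : 0 < n₀) (P : Protograph h₀ n₀ E) {α β : ℝ}
    {δ : Fin h₀ ⊕ Fin n₀ → ℝ} (hδ : δ ∈ weights h₀ n₀ α β) {κ : P.Config → ℝ}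
    (h0 : ∀ u, 0 ≤ κ u) (h1 : ∑ u, κ u = 1)
    (hκ : ∀ g, ∑ u, κ u * P.incidence u g = n₀ * δ (P.vn g)) : (P.ioFilter α β).NeBot := by
  have hn' : (0 : ℝ) < n₀ := by exact_mod_cast hn
  choose N m hN hm hrow using fun q : ℕ => exists_int_solution_near P.consistencyRow
    (P.limitPoint κ δ) _ (P.sum_consistencyRow_limitPoint h1 hκ)
    (ε := 1 / ((q : ℝ) + 1)) (by positivity)
  -- An integer within distance `1` of a nonnegative number exceeds `-1`.
  have hm0 : ∀ q v, 0 ≤ m q v := by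
    intro q v
    have h2 := (abs_lt.1 (hm q v)).2
    have h3 : 1 / ((q : ℝ) + 1) ≤ 1 := by
      rw [div_le_one (by positivity)]
      linarith [q.cast_nonneg (α := ℝ)]
    have h4 := mul_nonneg (N q).cast_nonneg (P.limitPoint_nonneg hn hδ h0 v)
    have h5 : (-1 : ℝ) < m q v := by linarith
    have h6 : (-1 : ℤ) < m q v := by exact_mod_cast h5
    omega
  set y : ℕ → P.Config ⊕ (Fin h₀ ⊕ Fin n₀) ⊕ (Fin h₀ ⊕ Fin n₀) → ℕ :=
    fun q v => (m q v).toNat with hy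
  have hym : ∀ q v, (m q v : ℤ) = y q v := fun q v => (Int.toNat_of_nonneg (hm0 q v)).symm
  have hlim : ∀ v, Tendsto (fun q => (y q v : ℝ) / N q) atTop (𝓝 (P.limitPoint κ δ v)) := by
    intro v
    refine tendsto_iff_norm_sub_tendsto_zero.2 (squeeze_zero (fun _ => norm_nonneg _) (fun q => ?_)
      tendsto_one_div_add_atTop_nhds_zero_nat)
    have hN1 : (1 : ℝ) ≤ N q := by exact_mod_cast hN q
    have h2 := (hm q v).le
    rw [hym, Int.cast_natCast] at h2
    have h3 : (y q v : ℝ) / N q - P.limitPoint κ δ v =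
        -((N q : ℝ) * P.limitPoint κ δ v - y q v) / N q := by
      field_simp
      ring
    rw [h3, Real.norm_eq_abs, abs_div, abs_neg, abs_of_pos (by linarith : (0 : ℝ) < N q)]
    exact (div_le_self (abs_nonneg _) hN1).trans h2
  -- The denominators `N q` may stay bounded; repeating every solution `q + 1` times drives `l` to
  -- infinity without changing the ratios.
  set t : ℕ → ℕ × ℕ × ℕ := fun q => ((q + 1) * N q,
    ∑ j, (q + 1) * y q (Sum.inr (Sum.inl (Sum.inl j))),
    ∑ j, (q + 1) * y q (Sum.inr (Sum.inl (Sum.inr j)))) with ht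
  have hweight : ∀ {W : Type} [Fintype W] (f : W → Fin h₀ ⊕ Fin n₀),
      Tendsto (fun q => ((∑ j, (q + 1) * y q (Sum.inr (Sum.inl (f j))) : ℕ) : ℝ) /
        ((n₀ : ℝ) * ((q + 1) * N q : ℕ))) atTop (𝓝 (∑ j, δ (f j))) := by
    intro W _ f
    have h2 := (tendsto_finsetSum Finset.univ fun j _ =>
      hlim (Sum.inr (Sum.inl (f j)))).div_const (n₀ : ℝ)
    have h3 : (∑ j, P.limitPoint κ δ (Sum.inr (Sum.inl (f j)))) / n₀ = ∑ j, δ (f j) := by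
      simp only [limitPoint, Sum.elim_inr, Sum.elim_inl, ← Finset.mul_sum]
      field_simp
    rw [h3] at h2
    refine h2.congr fun q => ?_
    have hN1 : (N q : ℝ) ≠ 0 := by exact_mod_cast (hN q).ne'
    rw [← Finset.sum_div, ← Finset.mul_sum]
    push_cast
    field_simp
  have htend : Tendsto t atTop (P.ioFilter α β) := by
    refine P.tendsto_ioFilter_iff.2 ⟨tendsto_weightFilter_iff.2 ⟨?_, ?_, ?_⟩, ?_⟩
    · refine tendsto_atTop_mono (fun q => ?_) tendsto_id
      have := hN q
      simp only [ht, id]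
      nlinarith
    · rw [← hδ.2.1]
      exact hweight Sum.inl
    · rw [← hδ.2.2]
      exact hweight Sum.inr
    · refine Eventually.of_forall fun q => ?_
      have r1 := hrow q (Sum.inl ())
      have r2 := fun j => hrow q (Sum.inr (Sum.inl j))
      have r3 := fun g => hrow q (Sum.inr (Sum.inr g))
      have e1 := P.sum_consistencyRow_total (R := ℤ) (fun v => (y q v : ℤ)) ()
      have e2 := P.sum_consistencyRow_weight (R := ℤ) (fun v => (y q v : ℤ))
      have e3 := P.sum_consistencyRow_edge (R := ℤ) (fun v => (y q v : ℤ))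
      simp only [Int.cast_id] at e1 e2 e3
      simp only [hym, e1, e2, e3, Sum.elim_inl, Sum.elim_inr, mul_one, mul_zero,
        sub_eq_zero] at r1 r2 r3
      have s1 : ∑ u, y q (Sum.inl u) = N q := by exact_mod_cast r1
      have s2 : ∀ j, y q (Sum.inr (Sum.inl j)) + y q (Sum.inr (Sum.inr j)) = N q :=
        fun j => by exact_mod_cast r2 j
      have s3 : ∀ g, ∑ u : P.Config, (if g ∈ u.1 then y q (Sum.inl u) else 0) =
          y q (Sum.inr (Sum.inl (P.vn g))) := fun g => by exact_mod_cast r3 g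
      have hle : ∀ j, (q + 1) * y q (Sum.inr (Sum.inl j)) ≤ (q + 1) * N q := fun j =>
        Nat.mul_le_mul_left _ (by have := s2 j; omega)
      refine lt_of_lt_of_le ?_ (P.typeEnum_le_avgEnum (mem_weightTypes.2 ⟨hle, rfl, rfl⟩))
      refine (P.log_typeEnum_ge hn hle (fun u => (q + 1) * y q (Sum.inl u)) ?_ fun g => ?_).1
      · rw [← Finset.mul_sum, s1]
      · rw [← s3 g, Finset.mul_sum]
        simp only [mul_ite, mul_zero]
  exact htend.neBot

/-- One distribution attaining the exponent serves both the nontriviality of the filter and the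
lower bound; optimality of `δ` enters only in the upper bound. -/
theorem hasRate_of_isOptimal (hn : 0 < n₀) (P : Protograph h₀ n₀ E) {α β G : ℝ}
    {δ : Fin h₀ ⊕ Fin n₀ → ℝ} (hδ : P.IsOptimal α β δ) (hG : P.J δ = (G : EReal)) :
    P.HasRate α β G := by
  obtain ⟨κ, h0, h1, hκ, hle⟩ := P.exists_entropy_ge hn δ G hG.ge
  refine ⟨P.ioFilter_neBot hn hδ.1 h0 h1 hκ, tendsto_order.2 ⟨fun x hx => ?_, fun x hx => ?_⟩⟩
  · exact P.eventually_lt_rate hn hδ.1 h0 h1 hκ (hx.trans_le hle)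
  · refine P.eventually_rate_lt hn fun δ' hδ' => ?_
    refine (isMaxOn_iff.1 hδ.2 δ' hδ').trans_lt ?_
    rw [hG]
    exact_mod_cast hx

/-- If the exponent is `⊥` on all admissible weights, the rate falls below every real number, in
particular below the floor given by `neg_le_log_avgEnum` for nonzero enumerators. -/
theorem eventually_avgEnum_eq_zero (hn : 0 < n₀) (P : Protograph h₀ n₀ E) {α β : ℝ}
    {δ : Fin h₀ ⊕ Fin n₀ → ℝ} (hδ : P.IsOptimal α β δ) (hJ : P.J δ = ⊥) :
    ∀ᶠ t in weightFilter n₀ α β, P.avgEnum t.1 t.2.1 t.2.2 = 0 := by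
  have hn' : (0 : ℝ) < n₀ := by exact_mod_cast hn
  have h1 := P.eventually_rate_lt hn (α := α) (β := β)
    (x := -(Fintype.card E * Real.log 2) / n₀) fun δ' hδ' => by
      refine (isMaxOn_iff.1 hδ.2 δ' hδ').trans_lt ?_
      rw [hJ]
      exact EReal.bot_lt_coe _
  have h2 : ∀ᶠ t in P.ioFilter α β, False := by
    filter_upwards [h1, P.eventually_ioFilter_pos α β] with t ht1 ht2
    have hl : (0 : ℝ) < t.1 := by exact_mod_cast ht2.1
    have h3 := P.neg_le_log_avgEnum ht2.2
    rw [one_div_mul_eq_div, div_lt_div_iff₀ (by positivity) hn'] at ht1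
    nlinarith
  rw [ioFilter, eventually_inf_principal] at h2
  filter_upwards [h2] with t ht
  exact le_antisymm (not_lt.1 ht) (P.avgEnum_nonneg _ _ _)

end Filters

end Protograph

namespace Protograph

/-! ### Lagrange multipliers at interior optimal weights -/

section Multipliers

variable {h₀ n₀ : ℕ} {E : Type*} [Fintype E] [DecidableEq E]

/-- Logarithmic edge weights on which every configuration has total weight zero. -/
def neutralWeights (P : Protograph h₀ n₀ E) : Submodule ℝ (E → ℝ) where
  carrier := {v | ∀ u, ∑ g, P.incidence u g * v g = 0}
  add_mem' := fun {v v'} hv hv' u => by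
    simp only [Set.mem_ofPred_eq] at hv hv'
    simp [mul_add, Finset.sum_add_distrib, hv u, hv' u]
  zero_mem' := fun u => by simp
  smul_mem' := fun c v hv u => by
    simp only [Set.mem_ofPred_eq] at hv
    have : ∀ g, P.incidence u g * (c • v) g = c * (P.incidence u g * v g) := fun g => by
      simp only [Pi.smul_apply, smul_eq_mul]
      ring
    simp only [this, ← Finset.mul_sum, hv u, mul_zero]

/-- Sums of edge weights at the variable nodes. -/
def vertexSum (P : Protograph h₀ n₀ E) : (E → ℝ) →ₗ[ℝ] (Fin h₀ ⊕ Fin n₀ → ℝ) where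
  toFun s j := ∑ g ∈ P.edgesV j, s g
  map_add' s s' := by
    funext j
    simp [Finset.sum_add_distrib]
  map_smul' c s := by
    funext j
    simp [Finset.mul_sum]

/-- Neutral edge weights do not change the Gibbs distribution. -/
theorem gibbsWeight_add_neutral (P : Protograph h₀ n₀ E) (s : E → ℝ) {v : E → ℝ}
    (hv : v ∈ P.neutralWeights) :
    gibbsWeight P.incidence (s + v) = gibbsWeight P.incidence s := by
  have hv' : ∀ u, ∑ g, P.incidence u g * v g = 0 := hv
  funext u
  simp only [gibbsWeight, Pi.add_apply, mul_add, Finset.sum_add_distrib, hv', add_zero]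

/-- A perturbation of the weights orthogonal to the neutral directions lifts to a perturbation of
the distribution on configurations. -/
theorem exists_config_perturbation (P : Protograph h₀ n₀ E) (θ : E → ℝ)
    (hθ : ∀ v ∈ P.neutralWeights, ∑ g, v g * θ g = 0) :
    ∃ ξ : P.Config → ℝ, ∑ u, ξ u = 0 ∧ ∀ g, ∑ u, ξ u * P.incidence u g = θ g := by
  have hmem : θ ∈ Submodule.span ℝ (Set.range P.incidence) := by
    refine mem_submodule_of_forall_sum_mul_eq_zero _ _ fun v hv => hθ v fun u => ?_
    rw [← hv _ (Submodule.subset_span (Set.mem_range_self u))]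
    exact Finset.sum_congr rfl fun g _ => mul_comm _ _
  obtain ⟨c, hc⟩ := (Submodule.mem_span_range_iff_exists_fun ℝ).1 hmem
  let e : P.Config := ⟨∅, by simp⟩
  have he : ∀ g, P.incidence e g = 0 := fun g => by simp [incidence, e]
  -- The empty configuration touches no edge, so it can absorb the total mass without changing the
  -- marginals.
  refine ⟨c - Pi.single e (∑ u, c u), ?_, fun g => ?_⟩
  · simp [Finset.sum_sub_distrib]
  · have h1 : ∀ u, (Pi.single e (∑ u, c u) : P.Config → ℝ) u * P.incidence u g = 0 := by
      intro u
      by_cases hu : u = e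
      · rw [hu, he, mul_zero]
      · rw [Pi.single_eq_of_ne hu, zero_mul]
    rw [← hc]
    simp only [Pi.sub_apply, sub_mul, h1, sub_zero, Finset.sum_apply, Pi.smul_apply, smul_eq_mul]

/-- First-order optimality of interior optimal weights along liftable perturbations. -/
theorem sum_mul_stationarity_eq_zero (hn : 0 < n₀) (P : Protograph h₀ n₀ E) {α β : ℝ}
    {δ η : Fin h₀ ⊕ Fin n₀ → ℝ} {z : E → ℝ} (hδ : P.IsOptimal α β δ)
    (hint : ∀ j, 0 < δ j ∧ δ j < 1 / (n₀ : ℝ)) (hz : P.IsSaddle z δ)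
    (hηin : ∑ j, η (Sum.inl j) = 0) (hηout : ∑ j, η (Sum.inr j) = 0)
    {ξ : P.Config → ℝ} (hξ : ∑ u, ξ u = 0)
    (hξη : ∀ g, ∑ u, ξ u * P.incidence u g = η (P.vn g)) :
    ∑ j, η j * (((P.degV j : ℝ) - 1) * Real.log (δ j / (1 / (n₀ : ℝ) - δ j)) -
      ∑ g ∈ P.edgesV j, Real.log (z g)) = 0 := by
  have hn' : (0 : ℝ) < n₀ := by exact_mod_cast hn
  set s : E → ℝ := fun g => Real.log (z g) with hs
  set q := gibbsWeight P.incidence s with hq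
  have hq0 : ∀ u, 0 < q u := gibbsWeight_pos _ _
  have hqm : ∀ g, ∑ u, q u * P.incidence u g = n₀ * δ (P.vn g) := ((P.isSaddle_iff z δ).1 hz).2
  -- Differentiability of `J` is not needed: along the lifted perturbation `Ψ` is an explicit lower
  -- bound for `J`, tight at `t = 0`, so it inherits the maximum. The factor `n₀` matches the
  -- marginals `n₀ δ`.
  set Ψ : ℝ → ℝ := fun t => 1 / (n₀ : ℝ) * ∑ u, Real.negMulLog (q u + t * (n₀ * ξ u)) -
    ∑ j, ((P.degV j : ℝ) - 1) / n₀ * Real.binEntropy (n₀ * (δ j + t * η j)) with hΨ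
  have hmax : IsLocalMax Ψ 0 := by
    have e1 : ∀ᶠ t : ℝ in 𝓝 0, ∀ u, 0 < q u + t * (n₀ * ξ u) := by
      refine eventually_all.2 fun u => ?_
      have : ContinuousAt (fun t : ℝ => q u + t * (n₀ * ξ u)) 0 := by fun_prop
      exact this.eventually (lt_mem_nhds (by simpa using hq0 u))
    have e2 : ∀ᶠ t : ℝ in 𝓝 0, ∀ j, 0 < δ j + t * η j ∧ δ j + t * η j < 1 / (n₀ : ℝ) := by
      refine eventually_all.2 fun j => ?_
      have : ContinuousAt (fun t : ℝ => δ j + t * η j) 0 := by fun_prop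
      exact (this.eventually (lt_mem_nhds (by simpa using (hint j).1))).and
        (this.eventually (gt_mem_nhds (by simpa using (hint j).2)))
    filter_upwards [e1, e2] with t h1 h2
    have hw : (fun j => δ j + t * η j) ∈ weights h₀ n₀ α β := by
      refine ⟨fun j => ⟨(h2 j).1.le, (h2 j).2.le⟩, ?_, ?_⟩
      · simp [Finset.sum_add_distrib, ← Finset.mul_sum, hηin, hδ.1.2.1]
      · simp [Finset.sum_add_distrib, ← Finset.mul_sum, hηout, hδ.1.2.2]
    have h3 := P.entropy_le_J hn (fun j => δ j + t * η j) (fun u => q u + t * (n₀ * ξ u))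
      (fun u => (h1 u).le)
      (by rw [Finset.sum_add_distrib, ← Finset.mul_sum, ← Finset.mul_sum, hξ, hq,
            sum_gibbsWeight]; simp)
      (fun g => by
        simp only [add_mul, Finset.sum_add_distrib, hqm, mul_assoc, ← Finset.mul_sum, hξη]
        ring)
    have h4 := h3.trans (isMaxOn_iff.1 hδ.2 _ hw)
    rw [P.J_eq_of_isSaddle hn hz, EReal.coe_le_coe_iff, P.Gexpr_eq_entropy hn hz] at h4
    simpa [hΨ, entropyV, hq] using h4
  have hderiv : HasDerivAt Ψ (1 / (n₀ : ℝ) * ∑ u, (-Real.log (q u) - 1) * (n₀ * ξ u) -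
      ∑ j, ((P.degV j : ℝ) - 1) / n₀ *
        ((Real.log (1 - n₀ * δ j) - Real.log (n₀ * δ j)) * (n₀ * η j))) 0 := by
    refine ((HasDerivAt.fun_sum fun u _ => ?_).const_mul _).sub
      (HasDerivAt.fun_sum fun j _ => HasDerivAt.const_mul _ ?_)
    · have h1 : HasDerivAt (fun t : ℝ => q u + t * (n₀ * ξ u)) (n₀ * ξ u) 0 := by
        simpa using ((hasDerivAt_id (0 : ℝ)).mul_const (n₀ * ξ u)).const_add (q u)
      have h2 : HasDerivAt Real.negMulLog (-Real.log (q u) - 1) (q u + 0 * (n₀ * ξ u)) := by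
        simpa using Real.hasDerivAt_negMulLog (hq0 u).ne'
      exact h2.comp 0 h1
    · have h1 : HasDerivAt (fun t : ℝ => n₀ * (δ j + t * η j)) (n₀ * η j) 0 := by
        simpa using (((hasDerivAt_id (0 : ℝ)).mul_const (η j)).const_add (δ j)).const_mul (n₀ : ℝ)
      have hpos : 0 < n₀ * δ j := mul_pos hn' (hint j).1
      have hlt : n₀ * δ j < 1 := by
        have := (hint j).2
        rwa [lt_div_iff₀ hn', mul_comm] at this
      have h2 : HasDerivAt Real.binEntropy (Real.log (1 - n₀ * δ j) - Real.log (n₀ * δ j))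
          (n₀ * (δ j + 0 * η j)) := by
        simpa using Real.hasDerivAt_binEntropy hpos.ne' hlt.ne
      exact h2.comp 0 h1
  have hzero := hmax.hasDerivAt_eq_zero hderiv
  -- The constants, including the log-partition function, drop out because `ξ` has total mass zero.
  have t1 : 1 / (n₀ : ℝ) * ∑ u, (-Real.log (q u) - 1) * (n₀ * ξ u) =
      -∑ g, η (P.vn g) * s g := by
    have h1 : ∀ u, (-Real.log (q u) - 1) * (n₀ * ξ u) =
        n₀ * ((logPartition P.incidence s - 1) * ξ u - ξ u * ∑ g, P.incidence u g * s g) := by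
      intro u
      rw [hq, log_gibbsWeight]
      ring
    simp only [h1, ← Finset.mul_sum, Finset.sum_sub_distrib, hξ,
      sum_mul_sum_comm P.incidence s ξ _ hξη]
    field_simp
    ring
  have t2 : ∀ j, ((P.degV j : ℝ) - 1) / n₀ *
      ((Real.log (1 - n₀ * δ j) - Real.log (n₀ * δ j)) * (n₀ * η j)) =
      -(η j * (((P.degV j : ℝ) - 1) * Real.log (δ j / (1 / (n₀ : ℝ) - δ j)))) := by
    intro j
    have h1 := (hint j).1
    have h2 : 0 < 1 / (n₀ : ℝ) - δ j := sub_pos.2 (hint j).2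
    have h3 : 1 - n₀ * δ j = n₀ * (1 / (n₀ : ℝ) - δ j) := by field_simp
    rw [h3, Real.log_mul hn'.ne' h2.ne', Real.log_mul hn'.ne' h1.ne', Real.log_div h1.ne' h2.ne']
    field_simp
    ring
  rw [t1] at hzero
  simp only [t2, Finset.sum_neg_distrib] at hzero
  have h5 := P.sum_edgesV η s
  simp only [mul_sub, Finset.sum_sub_distrib]
  linarith

/-- Interior optimal weights with a saddle point come from a solution of the full system. -/
theorem exists_isSolution (hn : 0 < n₀) (P : Protograph h₀ n₀ E) {α β : ℝ}
    {δ : Fin h₀ ⊕ Fin n₀ → ℝ} {z : E → ℝ} (hδ : P.IsOptimal α β δ)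
    (hint : ∀ j, 0 < δ j ∧ δ j < 1 / (n₀ : ℝ)) (hz : P.IsSaddle z δ) :
    ∃ z μ₁ μ₂, P.IsSolution α β z δ μ₁ μ₂ := by
  set s : E → ℝ := fun g => Real.log (z g) with hs
  set ρ : Fin h₀ ⊕ Fin n₀ → ℝ := fun j =>
    ((P.degV j : ℝ) - 1) * Real.log (δ j / (1 / (n₀ : ℝ) - δ j)) with hρ
  -- By the Fredholm alternative it suffices to test against `η` orthogonal to the right-hand space;
  -- such `η` keep both totals and lift to configurations, so first-order optimality applies.
  have hmem : ρ - P.vertexSum s ∈ P.neutralWeights.map P.vertexSum ⊔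
      Submodule.span ℝ {(Sum.elim 1 0 : Fin h₀ ⊕ Fin n₀ → ℝ),
        (Sum.elim 0 1 : Fin h₀ ⊕ Fin n₀ → ℝ)} := by
    refine mem_submodule_of_forall_sum_mul_eq_zero _ _ fun η hη => ?_
    have h1 := hη _ (Submodule.mem_sup_right (Submodule.subset_span (Set.mem_insert _ _)))
    have h2 := hη _ (Submodule.mem_sup_right
      (Submodule.subset_span (Set.mem_insert_of_mem _ (Set.mem_singleton _))))
    simp only [Fintype.sum_sum_type, Sum.elim_inl, Sum.elim_inr, Pi.one_apply, Pi.zero_apply,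
      mul_one, mul_zero, Finset.sum_const_zero, add_zero, zero_add] at h1 h2
    obtain ⟨ξ, hξ, hξη⟩ := P.exists_config_perturbation (fun g => η (P.vn g)) fun v hv => by
      have h3 := hη _ (Submodule.mem_sup_left (Submodule.mem_map_of_mem hv))
      have h4 := P.sum_edgesV η v
      change ∑ j, η j * ∑ g ∈ P.edgesV j, v g = 0 at h3
      rw [h4] at h3
      rw [← h3]
      exact Finset.sum_congr rfl fun g _ => mul_comm _ _
    exact P.sum_mul_stationarity_eq_zero hn hδ hint hz h1 h2 hξ hξη
  obtain ⟨_, ⟨v, hv, rfl⟩, _, hμ, hsum⟩ := Submodule.mem_sup.1 hmem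
  obtain ⟨μ₁, μ₂, rfl⟩ := Submodule.mem_span_pair.1 hμ
  have hst : ∀ j, ρ j = ∑ g ∈ P.edgesV j, (s + v) g +
      (μ₁ * (Sum.elim 1 0 : Fin h₀ ⊕ Fin n₀ → ℝ) j +
        μ₂ * (Sum.elim 0 1 : Fin h₀ ⊕ Fin n₀ → ℝ) j) := by
    intro j
    have h1 : P.vertexSum v j + (μ₁ * (Sum.elim 1 0 : Fin h₀ ⊕ Fin n₀ → ℝ) j +
        μ₂ * (Sum.elim 0 1 : Fin h₀ ⊕ Fin n₀ → ℝ) j) = ρ j - P.vertexSum s j := congrFun hsum j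
    have h2 : ∑ g ∈ P.edgesV j, (s + v) g = P.vertexSum s j + P.vertexSum v j :=
      Finset.sum_add_distrib
    rw [h2]
    linarith
  have hlog : ∀ g, Real.log (Real.exp ((s + v) g)) = (s + v) g := fun g => Real.log_exp _
  -- Multiplying `z` by `exp v` with `v` neutral leaves the Gibbs distribution, hence the
  -- saddle-point equations, unchanged while correcting the vertex sums.
  refine ⟨fun g => Real.exp ((s + v) g), μ₁, μ₂, hint, ?_, fun j => ?_, fun j => ?_,
    hδ.1.2.1, hδ.1.2.2⟩
  · refine (P.isSaddle_iff _ δ).2 ⟨fun g => Real.exp_pos _, ?_⟩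
    simp only [hlog]
    change ∀ g, ∑ u, gibbsWeight P.incidence (s + v) u * P.incidence u g = _
    rw [P.gibbsWeight_add_neutral s hv]
    exact ((P.isSaddle_iff z δ).1 hz).2
  · simp only [hlog]
    simpa [hρ] using hst (Sum.inl j)
  · simp only [hlog]
    simpa [hρ] using hst (Sum.inr j)

end Multipliers

end Protograph

/-! ### Assembly of the theorem -/

theorem theorem1 {h₀ n₀ : ℕ} (hn : 0 < n₀) {E : Type*} [Fintype E] [DecidableEq E]
    (P : Protograph h₀ n₀ E) (α β : ℝ)
    (hα : 0 ≤ α ∧ α ≤ (h₀ : ℝ) / n₀) (hβ : 0 ≤ β ∧ β ≤ 1) :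
    -- optimal weights exist
    (∃ δ, P.IsOptimal α β δ) ∧
    -- the limit exists and is the exponent of the optimal weights, unless no such weights occur
    (∀ δ, P.IsOptimal α β δ →
      (∃ G : ℝ, P.J δ = (G : EReal) ∧ P.HasRate α β G) ∨
      (P.J δ = ⊥ ∧ ∀ᶠ t in Protograph.weightFilter n₀ α β, P.avgEnum t.1 t.2.1 t.2.2 = 0)) ∧
    -- at a saddle point the exponent is the explicit expression
    (∀ z δ, P.IsSaddle z δ → P.J δ = (P.Gexpr z δ : EReal)) ∧
    (∀ z δ, P.IsOptimal α β δ → P.IsSaddle z δ → P.HasRate α β (P.Gexpr z δ)) ∧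
    -- optimal weights that are not on the boundary come from a solution of the system
    (∀ δ, P.IsOptimal α β δ → (∀ j, 0 < δ j ∧ δ j < 1 / (n₀ : ℝ)) → (∃ z, P.IsSaddle z δ) →
      ∃ z μ₁ μ₂, P.IsSolution α β z δ μ₁ μ₂ ∧ P.HasRate α β (P.Gexpr z δ)) ∧
    -- every solution of the system gives at most the limit, with equality at optimal weights
    (∀ z δ μ₁ μ₂, P.IsSolution α β z δ μ₁ μ₂ →
      (∀ G, P.HasRate α β G → P.Gexpr z δ ≤ G) ∧
      (P.IsOptimal α β δ → P.HasRate α β (P.Gexpr z δ))) := by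
  have hrate : ∀ z δ, P.IsOptimal α β δ → P.IsSaddle z δ → P.HasRate α β (P.Gexpr z δ) :=
    fun z δ hδ hz => P.hasRate_of_isOptimal hn hδ (P.J_eq_of_isSaddle hn hz)
  have hexists := P.exists_isOptimal hn hα hβ
  refine ⟨hexists, fun δ hδ => ?_, fun z δ hz => P.J_eq_of_isSaddle hn hz, hrate,
    fun δ hδ hint ⟨z, hz⟩ => ?_, fun z δ μ₁ μ₂ hsol => ⟨fun G hG => ?_, fun hδ => ?_⟩⟩
  · have htop : P.J δ ≠ ⊤ := by
      refine ((P.J_le (z := fun _ => 1) (fun _ => one_pos) δ).trans_lt ?_).ne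
      exact EReal.coe_lt_top _
    rcases eq_or_ne (P.J δ) ⊥ with hbot | hbot
    · exact Or.inr ⟨hbot, P.eventually_avgEnum_eq_zero hn hδ hbot⟩
    · have hG := (EReal.coe_toReal htop hbot).symm
      exact Or.inl ⟨_, hG, P.hasRate_of_isOptimal hn hδ hG⟩
  · obtain ⟨z', μ₁, μ₂, hsol⟩ := P.exists_isSolution hn hδ hint hz
    exact ⟨z', μ₁, μ₂, hsol, hrate z' δ hδ hsol.saddle⟩
  · obtain ⟨δ', hδ'⟩ := hexists
    have hmem : δ ∈ Protograph.weights h₀ n₀ α β :=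
      ⟨fun j => ⟨(hsol.interior j).1.le, (hsol.interior j).2.le⟩, hsol.sum_in, hsol.sum_out⟩
    have hle := isMaxOn_iff.1 hδ'.2 δ hmem
    rw [P.J_eq_of_isSaddle hn hsol.saddle] at hle
    have htop : P.J δ' ≠ ⊤ := by
      refine ((P.J_le (z := fun _ => 1) (fun _ => one_pos) δ').trans_lt ?_).ne
      exact EReal.coe_lt_top _
    -- The solution itself has a finite exponent, so the optimal one cannot be `⊥` and the limit is
    -- available for comparison.
    have hbot : P.J δ' ≠ ⊥ := ((EReal.bot_lt_coe _).trans_le hle).ne'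
    have hG' := (EReal.coe_toReal htop hbot).symm
    have hr := P.hasRate_of_isOptimal hn hδ' hG'
    have := hG.1
    rw [hG', tendsto_nhds_unique hr.2 hG.2, EReal.coe_le_coe_iff] at hle
    exact hle
  · exact hrate z δ hδ hsol.saddle
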